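/- Let $n\ge 1$ and let $\Omega\subset\mathbb R^n$ be an (open) simple convex polytope, that is, a nonempty bounded set of the form $\Omega=\bigcap_{i=1}^N\{l_i>0\}$ with $l_1,\dots,l_N$ affine functions, such that every vertex of $\overline\Omega$ lies on exactly $n$ faces of $\overline\Omega$ of codimension $1$. Let $\mu$ be a nonnegative Radon measure on $\Omega$ with $\mu(\Omega)<+\infty$, and let $g\in C(\partial\Omega)$ be convex on $\partial\Omega$, meaning that $g(tx+(1-t)y)\le t\,g(x)+(1-t)\,g(y)$ whenever $t\in[0,1]$ and $x,\,y,\,tx+(1-t)y\in\partial\Omega$. Then the Dirichlet problem $$\det D^2u=\mu\ \text{ in }\Omega,\qquad u=g\ \text{ on }\partial\Omega,$$ has a unique Alexandrov solution $u\in C(\overline\Omega)$. That is, there is exactly one $u\in C(\overline\Omega)$ that is convex in $\Omega$, equals $g$ on $\partial\Omega$, and satisfies $\bigl|\bigcup_{x\in B}\partial u(x)\bigr|=\mu(B)$ for every Borel set $B\subset\Omega$, where $\partial u(x)=\{p\in\mathbb R^n: u(y)\ge u(x)+p\cdot(y-x)\ \text{for all }y\in\Omega\}$ and $|\cdot|$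 denotes Lebesgue measure. -/

import Mathlib

/-- `F` is a facet (a face of codimension one) of the convex body `K` in `ℝⁿ`: a nonempty face cut
out by a supporting hyperplane, whose affine hull has dimension `n - 1`. -/
def IsFacet {n : ℕ} (K F : Set (EuclideanSpace ℝ (Fin n))) : Prop :=
  F.Nonempty ∧ IsExposed ℝ K F ∧ Module.finrank ℝ (vectorSpan ℝ F) + 1 = n

/-- `Ω` is an (open) simple convex polytope in `ℝⁿ`: a nonempty bounded intersection of finitely
many open half-spaces `{l i > 0}` with `l i` affine, such that every vertex of its closure lies on
exactly `n` facets of its closure. -/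
structure IsSimplePolytope {n : ℕ} (Ω : Set (EuclideanSpace ℝ (Fin n))) : Prop where
  nonempty : Ω.Nonempty
  bounded : Bornology.IsBounded Ω
  halfspaces : ∃ (N : ℕ) (l : Fin N → (EuclideanSpace ℝ (Fin n) →ᵃ[ℝ] ℝ)),
    Ω = {x | ∀ i, 0 < l i x}
  simple : ∀ p ∈ (closure Ω).extremePoints ℝ,
    {F | IsFacet (closure Ω) F ∧ p ∈ F}.encard = n

/-- `g` is a convex function on the (usually non-convex) set `S`: the convexity inequality holds
whenever both end points and the intermediate point lie in `S`. -/
def ConvexAlong {n : ℕ} (S : Set (EuclideanSpace ℝ (Fin n)))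
    (g : EuclideanSpace ℝ (Fin n) → ℝ) : Prop :=
  ∀ x ∈ S, ∀ y ∈ S, ∀ t ∈ Set.Icc (0 : ℝ) 1, t • x + (1 - t) • y ∈ S →
    g (t • x + (1 - t) • y) ≤ t * g x + (1 - t) * g y

/-- The subdifferential at `x` of a function `u` on `Ω`: the slopes `p` of the affine functions that
touch `u` at `x` and lie below `u` on `Ω`. -/
def subdiff {n : ℕ} (Ω : Set (EuclideanSpace ℝ (Fin n))) (u : EuclideanSpace ℝ (Fin n) → ℝ)
    (x : EuclideanSpace ℝ (Fin n)) : Set (EuclideanSpace ℝ (Fin n)) :=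
  {p | ∀ y ∈ Ω, u x + inner ℝ p (y - x) ≤ u y}

/-- The Monge–Ampère measure of `u` on `Ω`, evaluated at `B ⊆ Ω`: the Lebesgue measure of the image
of `B` under the subdifferential of `u`. -/
noncomputable def mongeAmpere {n : ℕ} (Ω : Set (EuclideanSpace ℝ (Fin n)))
    (u : EuclideanSpace ℝ (Fin n) → ℝ) (B : Set (EuclideanSpace ℝ (Fin n))) : ENNReal :=
  MeasureTheory.volume (⋃ x ∈ B, subdiff Ω u x)

/-- `u ∈ C(closure Ω)` is an Alexandrov solution of `det D²u = μ` in `Ω`, `u = g` on `∂Ω`.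
Only the values of `u` on `closure Ω`, of `g` on `∂Ω` and of `μ` on Borel subsets of `Ω` matter. -/
structure IsAlexandrovSolution {n : ℕ} (Ω : Set (EuclideanSpace ℝ (Fin n)))
    (μ : MeasureTheory.Measure (EuclideanSpace ℝ (Fin n)))
    (g u : EuclideanSpace ℝ (Fin n) → ℝ) : Prop where
  continuousOn : ContinuousOn u (closure Ω)
  convexOn : ConvexOn ℝ Ω u
  mongeAmpere_eq : ∀ B ⊆ Ω, MeasurableSet B → mongeAmpere Ω u B = μ B
  boundary : ∀ x ∈ frontier Ω, u x = g x

/-! The proof is variational and works in the dual variable. Write `w*` for the Legendre transform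
of `w` over `closure Ω` and `g*` for that of `g` over `frontier Ω`. The functional is `J w = ∫ (w* -
g*) dp + ∫_Ω w dμ`. Perturbing `w` by `tφ` changes `w* p` to first order by `-t φ(∇w* p)`, so a
minimiser `u` satisfies `∫ φ(∇u* p) dp = ∫_Ω φ dμ`: the image of Lebesgue measure under `∇u*` is `μ`
on `Ω`. Since `p ∈ ∂u(x)` exactly when `x` maximises `p·x - u x`, and for almost every `p` the only
maximiser is `∇u* p`, this image is the Monge–Ampère measure of `u` (`mongeAmpere_eq_map_gradient`).

A minimiser is found by order rather than compactness: `J (w ⊔ v) + J (w ⊓ v) ≤ J w + J v`, so the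
upper limit of a rapidly minimising sequence is a minimiser, and its convex envelope is no worse.
Boundary values survive because a function of finite energy cannot drop below `g` near the boundary:
otherwise `∫ (w* - g*)` would exceed an infinite integral, taken along an outward normal. This needs
`g` to be a supremum of affine functions on the boundary. For a polytope that follows from convexity
of `g` along the boundary, since a convex combination of points of `closure Ω` that lies on a face
uses only points of that face.

For uniqueness, testing the transforms of two solutions `u`, `v` at each other's maximisers and
integrating gives equality almost everywhere, whence `((u + v) / 2)* = (u* + v*) / 2`. Every
subgradient of the mean is then common to `u` and `v`, so `u - v` is constant, and it vanishes on
the boundary. -/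

open MeasureTheory Filter Topology Set Metric

set_option linter.unusedSectionVars false

/-! ### Functions bounded below on a set. -/

section BddBelowOn

variable {X : Type*}

/-- `w` is bounded below on `A`. -/
def BddBelowOn (A : Set X) (w : X → ℝ) : Prop := ∃ m : ℝ, ∀ x ∈ A, m ≤ w x

theorem BddBelowOn.of_le {A : Set X} {w v : X → ℝ} (h : BddBelowOn A w)
    (hwv : ∀ x ∈ A, w x ≤ v x) : BddBelowOn A v := by
  obtain ⟨m, hm⟩ := h
  exact ⟨m, fun x hx => (hm x hx).trans (hwv x hx)⟩

theorem IsCompact.bddBelowOn [TopologicalSpace X] {A : Set X} (hA : IsCompact A) {w : X → ℝ} (hw : ContinuousOn w A) :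
    BddBelowOn A w := by
  obtain ⟨m, hm⟩ := hA.bddBelow_image hw
  exact ⟨m, fun x hx => hm (mem_image_of_mem w hx)⟩

end BddBelowOn

/-! ### Legendre transforms and convex envelopes on bounded sets. -/

section Legendre

variable {V : Type*} [NormedAddCommGroup V] [InnerProductSpace ℝ V]

/-- The Legendre transform of the restriction of `w` to `A`. -/
noncomputable def legendreOn (A : Set V) (w : V → ℝ) (p : V) : ℝ :=
  sSup ((fun x => inner ℝ p x - w x) '' A)

theorem inner_sub_le_legendreOn {A : Set V} (hA : Bornology.IsBounded A) {w : V → ℝ}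
    (hw : BddBelowOn A w) (p : V) {x : V} (hx : x ∈ A) :
    inner ℝ p x - w x ≤ legendreOn A w p := by
  obtain ⟨D, hD⟩ := hA.exists_norm_le
  obtain ⟨m, hm⟩ := hw
  refine le_csSup ⟨‖p‖ * D - m, ?_⟩ (mem_image_of_mem _ hx)
  rintro _ ⟨y, hy, rfl⟩
  have h1 : inner ℝ p y ≤ ‖p‖ * ‖y‖ := real_inner_le_norm p y
  have h2 : ‖p‖ * ‖y‖ ≤ ‖p‖ * D := mul_le_mul_of_nonneg_left (hD y hy) (norm_nonneg p)
  have h3 := hm y hy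
  show inner ℝ p y - w y ≤ _
  linarith

theorem legendreOn_le {A : Set V} (hne : A.Nonempty) {w : V → ℝ} {p : V} {c : ℝ}
    (h : ∀ x ∈ A, inner ℝ p x - w x ≤ c) : legendreOn A w p ≤ c := by
  refine csSup_le (hne.image _) ?_
  rintro _ ⟨y, hy, rfl⟩
  exact h y hy

theorem legendreOn_le_add_inner {A : Set V} (hA : Bornology.IsBounded A) (hne : A.Nonempty)
    {w : V → ℝ} (hw : BddBelowOn A w) {p q : V} {c : ℝ} (h : ∀ x ∈ A, inner ℝ q x ≤ c) :
    legendreOn A w (p + q) ≤ legendreOn A w p + c := by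
  refine legendreOn_le hne fun x hx => ?_
  have h1 := inner_sub_le_legendreOn hA hw p hx
  have h2 := h x hx
  rw [inner_add_left]
  linarith

theorem legendreOn_le_add_norm {A : Set V} (hne : A.Nonempty) {D : ℝ}
    (hD : ∀ x ∈ A, ‖x‖ ≤ D) {w : V → ℝ} (hw : BddBelowOn A w) (p q : V) :
    legendreOn A w q ≤ legendreOn A w p + D * ‖q - p‖ := by
  have hA : Bornology.IsBounded A := isBounded_iff_forall_norm_le.2 ⟨D, hD⟩
  have := legendreOn_le_add_inner hA hne hw (p := p) (q := q - p) (c := D * ‖q - p‖)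
    fun x hx => (real_inner_le_norm _ _).trans <| by
      rw [mul_comm]
      exact mul_le_mul_of_nonneg_right (hD x hx) (norm_nonneg _)
  simpa using this

theorem exists_lipschitzWith_legendreOn {A : Set V} (hA : Bornology.IsBounded A)
    (hne : A.Nonempty) {w : V → ℝ} (hw : BddBelowOn A w) :
    ∃ C, LipschitzWith C (legendreOn A w) := by
  obtain ⟨D, hD⟩ := hA.exists_norm_le
  have hD0 : 0 ≤ D := by
    obtain ⟨x, hx⟩ := hne
    exact (norm_nonneg x).trans (hD x hx)
  refine ⟨D.toNNReal, LipschitzWith.of_dist_le_mul fun p q => ?_⟩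
  rw [Real.coe_toNNReal D hD0, Real.dist_eq, abs_le, dist_eq_norm]
  have h1 := legendreOn_le_add_norm hne hD hw p q
  have h2 := legendreOn_le_add_norm hne hD hw q p
  rw [norm_sub_rev] at h1
  constructor <;> linarith

theorem continuous_legendreOn {A : Set V} (hA : Bornology.IsBounded A)
    (hne : A.Nonempty) {w : V → ℝ} (hw : BddBelowOn A w) : Continuous (legendreOn A w) :=
  let ⟨_, h⟩ := exists_lipschitzWith_legendreOn hA hne hw
  h.continuous

theorem legendreOn_mono_set {A B : Set V} (hB : Bornology.IsBounded B) (hne : A.Nonempty)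
    (hAB : A ⊆ B) {w g : V → ℝ} (hw : BddBelowOn B w) (h : ∀ x ∈ A, w x ≤ g x) (p : V) :
    legendreOn A g p ≤ legendreOn B w p := by
  refine legendreOn_le hne fun x hx => ?_
  have h1 := inner_sub_le_legendreOn hB hw p (hAB hx)
  have h2 := h x hx
  linarith

theorem legendreOn_anti {A : Set V} (hA : Bornology.IsBounded A) (hne : A.Nonempty)
    {w v : V → ℝ} (hw : BddBelowOn A w) (h : ∀ x ∈ A, w x ≤ v x) (p : V) :
    legendreOn A v p ≤ legendreOn A w p :=
  legendreOn_mono_set hA hne subset_rfl hw h p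

/-- At each point the minimum is one of the two values. This is the half of submodularity that does
not follow from monotonicity. -/
theorem legendreOn_inf_le {A : Set V} (hA : Bornology.IsBounded A) (hne : A.Nonempty)
    {w v : V → ℝ} (hw : BddBelowOn A w) (hv : BddBelowOn A v) (p : V) :
    legendreOn A (w ⊓ v) p ≤ max (legendreOn A w p) (legendreOn A v p) := by
  refine legendreOn_le hne fun x hx => ?_
  have h1 := inner_sub_le_legendreOn hA hw p hx
  have h2 := inner_sub_le_legendreOn hA hv p hx
  rw [Pi.inf_apply]
  rcases min_choice (w x) (v x) with h | h
  · exact le_max_of_le_left (by rw [h]; exact h1)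
  · exact le_max_of_le_right (by rw [h]; exact h2)

/-- Midpoint convexity of the transform in the function; uniqueness rests on its equality case. -/
theorem legendreOn_half_add_le {A : Set V} (hA : Bornology.IsBounded A) (hne : A.Nonempty)
    {w v : V → ℝ} (hw : BddBelowOn A w) (hv : BddBelowOn A v) (p : V) :
    legendreOn A (fun x => (w x + v x) / 2) p ≤ (legendreOn A w p + legendreOn A v p) / 2 := by
  refine legendreOn_le hne fun x hx => ?_
  have h1 := inner_sub_le_legendreOn hA hw p hx
  have h2 := inner_sub_le_legendreOn hA hv p hx
  linarith

theorem abs_legendreOn_sub_le {A : Set V} (hA : Bornology.IsBounded A) (hne : A.Nonempty)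
    {w v : V → ℝ} {c : ℝ} (hw : BddBelowOn A w) (h : ∀ x ∈ A, |v x - w x| ≤ c) (p : V) :
    |legendreOn A v p - legendreOn A w p| ≤ c := by
  have hv : BddBelowOn A v := by
    obtain ⟨m, hm⟩ := hw
    exact ⟨m - c, fun x hx => by have := hm x hx; have := abs_le.1 (h x hx); linarith⟩
  have h1 : legendreOn A v p ≤ legendreOn A w p + c := legendreOn_le hne fun x hx => by
    have := inner_sub_le_legendreOn hA hw p hx
    have := abs_le.1 (h x hx)
    linarith
  have h2 : legendreOn A w p ≤ legendreOn A v p + c := legendreOn_le hne fun x hx => by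
    have := inner_sub_le_legendreOn hA hv p hx
    have := abs_le.1 (h x hx)
    linarith
  rw [abs_le]
  constructor <;> linarith

theorem exists_legendreOn_eq {A : Set V} (hA : IsCompact A) (hne : A.Nonempty) {w : V → ℝ}
    (hw : ContinuousOn w A) (p : V) : ∃ x ∈ A, legendreOn A w p = inner ℝ p x - w x := by
  have hc : ContinuousOn (fun x => inner ℝ p x - w x) A := by fun_prop
  obtain ⟨x, hx, h⟩ := hA.exists_sSup_image_eq hne hc
  exact ⟨x, hx, h⟩

/-- A maximiser in the definition of the Legendre transform is its gradient. -/
theorem gradient_legendreOn_eq [CompleteSpace V] {A : Set V} (hA : Bornology.IsBounded A)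
    {w : V → ℝ} (hw : BddBelowOn A w) {p x : V} (hd : DifferentiableAt ℝ (legendreOn A w) p)
    (hx : x ∈ A) (h : legendreOn A w p = inner ℝ p x - w x) :
    gradient (legendreOn A w) p = x := by
  -- This function of `q` is at least `-w x`, with equality at `p`.
  have hmin : IsLocalMin (fun q => legendreOn A w q - inner ℝ x q) p := by
    refine Eventually.of_forall fun q => ?_
    have h1 := inner_sub_le_legendreOn hA hw q hx
    show legendreOn A w p - inner ℝ x p ≤ legendreOn A w q - inner ℝ x q
    rw [h, real_inner_comm p x, real_inner_comm q x]
    linarith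
  have h1 : HasFDerivAt (fun q => legendreOn A w q - inner ℝ x q)
      (fderiv ℝ (legendreOn A w) p - innerSL ℝ x) p :=
    hd.hasFDerivAt.sub ((innerSL ℝ x).hasFDerivAt)
  have h2 := hmin.hasFDerivAt_eq_zero h1
  rw [sub_eq_zero] at h2
  rw [gradient, h2]
  exact (InnerProductSpace.toDual ℝ V).symm_apply_apply x

/-- The convex envelope of the restriction of `w` to `A`, on `A`. -/
noncomputable def biconjOn (A : Set V) (w : V → ℝ) (x : V) : ℝ :=
  ⨆ p, (inner ℝ p x - legendreOn A w p)

section biconj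

variable {A : Set V} (hA : Bornology.IsBounded A) {w : V → ℝ} (hw : BddBelowOn A w)

include hA hw

theorem bddAbove_range_biconjOn {x : V} (hx : x ∈ A) :
    BddAbove (range fun p => inner ℝ p x - legendreOn A w p) := by
  refine ⟨w x, ?_⟩
  rintro _ ⟨p, rfl⟩
  have := inner_sub_le_legendreOn hA hw p hx
  show inner ℝ p x - legendreOn A w p ≤ w x
  linarith

theorem biconjOn_le {x : V} (hx : x ∈ A) : biconjOn A w x ≤ w x := by
  refine ciSup_le fun p => ?_
  have := inner_sub_le_legendreOn hA hw p hx
  linarith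

theorem inner_sub_legendreOn_le_biconjOn {x : V} (hx : x ∈ A) (p : V) :
    inner ℝ p x - legendreOn A w p ≤ biconjOn A w x :=
  le_ciSup (bddAbove_range_biconjOn hA hw hx) p

theorem bddBelowOn_biconjOn : BddBelowOn A (biconjOn A w) :=
  ⟨-legendreOn A w 0, fun x hx => by
    have := inner_sub_legendreOn_le_biconjOn hA hw hx 0
    simpa using this⟩

/-- The envelope therefore has the same energy, which allows a minimiser to be replaced by a convex
one. -/
theorem legendreOn_biconjOn (hne : A.Nonempty) : legendreOn A (biconjOn A w) = legendreOn A w := by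
  funext p
  refine le_antisymm (legendreOn_le hne fun x hx => ?_) ?_
  · have := inner_sub_legendreOn_le_biconjOn hA hw hx p
    linarith
  · exact legendreOn_anti hA hne (bddBelowOn_biconjOn hA hw) (fun x hx => biconjOn_le hA hw hx) p

theorem convexOn_biconjOn (hc : Convex ℝ A) : ConvexOn ℝ A (biconjOn A w) := by
  refine ⟨hc, fun x hx y hy a b ha hb hab => ciSup_le fun p => ?_⟩
  have h1 := mul_le_mul_of_nonneg_left (inner_sub_legendreOn_le_biconjOn hA hw hx p) ha
  have h2 := mul_le_mul_of_nonneg_left (inner_sub_legendreOn_le_biconjOn hA hw hy p) hb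
  rw [inner_add_right, real_inner_smul_right, real_inner_smul_right, smul_eq_mul, smul_eq_mul]
  have h3 : legendreOn A w p = a * legendreOn A w p + b * legendreOn A w p := by
    rw [← add_mul, hab, one_mul]
  linarith

end biconj

end Legendre

/-! ### Convex domains: boundary points, normals, supporting functions. -/

section Domain

variable {V : Type*} [NormedAddCommGroup V] [InnerProductSpace ℝ V]

/-- `Ω` is a nonempty bounded open convex set. -/
structure IsConvexDomain (Ω : Set V) : Prop where
  isOpen : IsOpen Ω
  convex : Convex ℝ Ω
  bounded : Bornology.IsBounded Ω
  nonempty : Ω.Nonempty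

namespace IsConvexDomain

variable {Ω : Set V} (hΩ : IsConvexDomain Ω)

include hΩ

theorem bounded_closure : Bornology.IsBounded (closure Ω) := hΩ.bounded.closure

theorem nonempty_closure : (closure Ω).Nonempty := hΩ.nonempty.closure

theorem mem_frontier {x : V} (hx : x ∈ closure Ω) (hx' : x ∉ Ω) : x ∈ frontier Ω := by
  rw [hΩ.isOpen.frontier_eq]
  exact ⟨hx, hx'⟩

theorem notMem_of_mem_frontier {x : V} (hx : x ∈ frontier Ω) : x ∉ Ω := by
  rw [hΩ.isOpen.frontier_eq] at hx
  exact hx.2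

theorem isCompact_closure [FiniteDimensional ℝ V] : IsCompact (closure Ω) :=
  hΩ.bounded.isCompact_closure

theorem isCompact_frontier [FiniteDimensional ℝ V] : IsCompact (frontier Ω) :=
  hΩ.isCompact_closure.of_isClosed_subset isClosed_frontier frontier_subset_closure

theorem exists_mem_frontier_inner_le [FiniteDimensional ℝ V] [Nontrivial V] {x : V}
    (hx : x ∈ closure Ω) (p : V) : ∃ y ∈ frontier Ω, inner ℝ p x ≤ inner ℝ p y := by
  have key : ∀ e : V, e ≠ 0 → ∃ y ∈ frontier Ω, inner ℝ e x ≤ inner ℝ e y := by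
    intro e he
    obtain ⟨y, hy, hmax⟩ := hΩ.isCompact_closure.exists_isMaxOn hΩ.nonempty_closure
      (f := fun y => inner ℝ e y) (by fun_prop)
    refine ⟨y, hΩ.mem_frontier hy fun hyΩ => ?_, hmax hx⟩
    have hc : Tendsto (fun s : ℝ => y + s • e) (𝓝[>] 0) (𝓝 y) := by
      have : Continuous fun s : ℝ => y + s • e := by fun_prop
      simpa using (this.tendsto 0).mono_left nhdsWithin_le_nhds
    obtain ⟨s, hs, hs0⟩ := ((hc.eventually (hΩ.isOpen.mem_nhds hyΩ)).and
      self_mem_nhdsWithin).exists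
    have h1 : inner ℝ e (y + s • e) ≤ inner ℝ e y := hmax (subset_closure hs)
    rw [inner_add_right, real_inner_smul_right] at h1
    have h2 : 0 < s * inner ℝ e e := mul_pos hs0 (real_inner_self_pos.2 he)
    linarith
  rcases eq_or_ne p 0 with rfl | hp
  · obtain ⟨e, he⟩ := exists_ne (0 : V)
    obtain ⟨y, hy, -⟩ := key e he
    exact ⟨y, hy, by simp⟩
  · exact key p hp

theorem nonempty_frontier [FiniteDimensional ℝ V] [Nontrivial V] : (frontier Ω).Nonempty := by
  obtain ⟨x, hx⟩ := hΩ.nonempty_closure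
  obtain ⟨y, hy, -⟩ := hΩ.exists_mem_frontier_inner_le hx 0
  exact ⟨y, hy⟩

theorem exists_normal [CompleteSpace V] {x₀ : V} (hx₀ : x₀ ∈ frontier Ω) :
    ∃ ν : V, ν ≠ 0 ∧ ∀ y ∈ closure Ω, inner ℝ ν y ≤ inner ℝ ν x₀ := by
  obtain ⟨f, hf⟩ := geometric_hahn_banach_open_point hΩ.convex hΩ.isOpen
    (hΩ.notMem_of_mem_frontier hx₀)
  set ν := (InnerProductSpace.toDual ℝ V).symm f
  have hν : ∀ y, inner ℝ ν y = f y := fun y => InnerProductSpace.toDual_symm_apply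
  refine ⟨ν, fun h0 => ?_, fun y hy => ?_⟩
  · obtain ⟨z, hz⟩ := hΩ.nonempty
    have := hf z hz
    rw [← hν, ← hν, h0, inner_zero_left, inner_zero_left] at this
    exact lt_irrefl _ this
  · have hcl : IsClosed {y : V | inner ℝ ν y ≤ inner ℝ ν x₀} :=
      isClosed_le (by fun_prop) continuous_const
    refine closure_minimal (fun y hy => ?_) hcl hy
    show inner ℝ ν y ≤ inner ℝ ν x₀
    rw [hν, hν]
    exact (hf y hy).le

/-- A convex function on the closure of `Ω` whose boundary values are continuous is upper
semicontinuous at the boundary. -/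
theorem eventually_lt_of_convexOn {u g : V → ℝ} (hu : ConvexOn ℝ (closure Ω) u)
    (hg : ContinuousOn g (frontier Ω)) (hug : EqOn u g (frontier Ω)) {x₀ : V}
    (hx₀ : x₀ ∈ frontier Ω) {c : ℝ} (hc : g x₀ < c) : ∀ᶠ x in 𝓝[closure Ω] x₀, u x < c := by
  obtain ⟨z, hz⟩ := hΩ.nonempty
  have hx₀' := hΩ.notMem_of_mem_frontier hx₀
  let T : V ≃ₜ V := Homeomorph.addLeft z
  let s : Set V := T ⁻¹' Ω
  have hTa : ∀ v, T v = z + v := fun v => rfl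
  have hsc : Convex ℝ s := by
    have : s = (fun v => z + v) ⁻¹' Ω := rfl
    rw [this]
    exact hΩ.convex.translate_preimage_right z
  have hs0 : s ∈ 𝓝 (0 : V) := by
    refine (hΩ.isOpen.preimage T.continuous).mem_nhds ?_
    show T 0 ∈ Ω
    rwa [hTa, add_zero]
  have hfr : ∀ v, gauge s v = 1 ↔ z + v ∈ frontier Ω := by
    intro v
    rw [gauge_eq_one_iff_mem_frontier hsc hs0, ← T.preimage_frontier]
    rfl
  have hcl : ∀ v, gauge s v ≤ 1 ↔ z + v ∈ closure Ω := by
    intro v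
    rw [gauge_le_one_iff_mem_closure hsc hs0, ← T.preimage_closure]
    rfl
  -- Radial coordinates about `z`: the ray from `z` through `x` leaves the domain at `y x`, and `x =
  -- (1 - r x) z + r x (y x)`. Convexity bounds `u x` by `(1 - r x) u z + r x g (y x)`, which tends
  -- to `g x₀`.
  let r : V → ℝ := fun x => gauge s (x - z)
  let y : V → V := fun x => z + (r x)⁻¹ • (x - z)
  have hrc : Continuous r := (continuous_gauge hsc hs0).comp (by fun_prop)
  have hr₀ : r x₀ = 1 := (hfr _).2 (by simpa using hx₀)
  have hy₀ : y x₀ = x₀ := by simp [y, hr₀]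
  have hyc : ContinuousAt y x₀ := by
    have : ContinuousAt (fun x => (r x)⁻¹) x₀ := hrc.continuousAt.inv₀ (by rw [hr₀]; exact one_ne_zero)
    fun_prop
  have hrpos : ∀ᶠ x in 𝓝 x₀, 0 < r x :=
    hrc.continuousAt.eventually (lt_mem_nhds (by rw [hr₀]; exact one_pos))
  have hyfr : ∀ᶠ x in 𝓝 x₀, y x ∈ frontier Ω := by
    filter_upwards [hrpos] with x hx
    rw [← hfr, gauge_smul_of_nonneg (inv_nonneg.2 hx.le), smul_eq_mul]
    exact inv_mul_cancel₀ hx.ne'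
  have hty : Tendsto y (𝓝 x₀) (𝓝[frontier Ω] x₀) := by
    refine tendsto_nhdsWithin_iff.2 ⟨?_, hyfr⟩
    have := hyc.tendsto
    rwa [hy₀] at this
  have hlim : Tendsto (fun x => (1 - r x) * u z + r x * g (y x)) (𝓝 x₀) (𝓝 (g x₀)) := by
    have h1 : Tendsto (fun x => g (y x)) (𝓝 x₀) (𝓝 (g x₀)) := (hg x₀ hx₀).tendsto.comp hty
    have h2 : Tendsto r (𝓝 x₀) (𝓝 1) := hr₀ ▸ hrc.tendsto x₀
    have h3 := (((tendsto_const_nhds (x := (1 : ℝ))).sub h2).mul_const (u z)).add (h2.mul h1)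
    simpa using h3
  have hev := hlim.eventually (gt_mem_nhds hc)
  filter_upwards [nhdsWithin_le_nhds hev, nhdsWithin_le_nhds hrpos, nhdsWithin_le_nhds hyfr,
    self_mem_nhdsWithin] with x hx hrx hyx hxK
  refine lt_of_le_of_lt ?_ hx
  have hr1 : r x ≤ 1 := (hcl _).2 (by simpa using hxK)
  have h := hu.2 (subset_closure hz) (frontier_subset_closure hyx) (sub_nonneg.2 hr1) hrx.le
    (sub_add_cancel 1 (r x))
  have hcomb : (1 - r x) • z + r x • y x = x := by
    simp only [y, smul_add, smul_smul, mul_inv_cancel₀ hrx.ne', one_smul, sub_smul]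
    abel
  rw [hcomb, hug hyx] at h
  simpa using h

end IsConvexDomain

/-- A supporting affine function exists at every point of the domain of a convex function. -/
theorem ConvexOn.exists_inner_le [FiniteDimensional ℝ V] {Ω : Set V} (hΩ : IsOpen Ω) {w : V → ℝ}
    (hw : ConvexOn ℝ Ω w) {x : V} (hx : x ∈ Ω) :
    ∃ p : V, ∀ y ∈ Ω, w x + inner ℝ p (y - x) ≤ w y := by
  have hcont : ContinuousOn w Ω := hw.continuousOn hΩ
  have hopen : IsOpen {q : V × ℝ | q.1 ∈ Ω ∧ w q.1 < q.2} := by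
    have h1 : IsOpen (Ω ×ˢ (univ : Set ℝ)) := hΩ.prod isOpen_univ
    have h2 : ContinuousOn (fun q : V × ℝ => q.2 - w q.1) (Ω ×ˢ (univ : Set ℝ)) :=
      continuousOn_snd.sub (hcont.comp continuousOn_fst fun q hq => hq.1)
    have h3 := h2.isOpen_inter_preimage h1 isOpen_Ioi (t := Ioi 0)
    convert h3 using 1
    ext q
    simp
  -- Separate the graph point from the open strict epigraph; the vertical coefficient `a` is
  -- negative, and dividing by `-a` gives the slope.
  obtain ⟨f, hf⟩ := geometric_hahn_banach_open_point hw.convex_strict_epigraph hopen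
    (x := (x, w x)) (by simp)
  set a := f (0, 1)
  have hsplit : ∀ (y : V) (t : ℝ), f (y, t) = f (y, 0) + t * a := by
    intro y t
    have : ((y, t) : V × ℝ) = (y, 0) + t • (0, 1) := by simp
    rw [this, map_add, map_smul, smul_eq_mul]
  have ha : a < 0 := by
    have := hf (x, w x + 1) ⟨hx, by simp⟩
    rw [hsplit x (w x + 1), hsplit x (w x)] at this
    linarith
  let L : V →L[ℝ] ℝ := f.comp (ContinuousLinearMap.inl ℝ V ℝ)
  have hL : ∀ y, L y = f (y, 0) := fun y => rfl
  refine ⟨(InnerProductSpace.toDual ℝ V).symm ((-a)⁻¹ • L), fun y hy => ?_⟩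
  rw [InnerProductSpace.toDual_symm_apply, smul_apply, smul_eq_mul, map_sub,
    hL, hL]
  have key : f (y, 0) + w y * a ≤ f (x, 0) + w x * a := by
    refine le_of_forall_pos_lt_add fun ε hε => ?_
    have h1 := hf (y, w y + ε / (-a)) ⟨hy, by simpa using div_pos hε (neg_pos.2 ha)⟩
    rw [hsplit y, hsplit x] at h1
    have h2 : ε / (-a) * a = -ε := by
      have := ha.ne
      field_simp
    linarith
  have h3 : (-a)⁻¹ * (f (y, 0) - f (x, 0)) ≤ (-a)⁻¹ * ((w x - w y) * a) :=
    mul_le_mul_of_nonneg_left (by linarith) (inv_nonneg.2 (by linarith))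
  have h4 : (-a)⁻¹ * ((w x - w y) * a) = w y - w x := by
    have := ha.ne
    field_simp
    ring
  linarith

/-! ### Divergent integrals along a direction. -/

section Infinite

variable [MeasurableSpace V] [BorelSpace V] [FiniteDimensional ℝ V]

/-- A set containing all the translates of a ball by nonnegative multiples of a vector has
infinite measure. -/
theorem volume_eq_top_of_forall_ball_subset {A : Set V} {p ν : V} {ρ : ℝ} (hρ : 0 < ρ) (hν : ν ≠ 0)
    (h : ∀ q ∈ ball p ρ, ∀ s : ℝ, 0 ≤ s → q + s • ν ∈ A) : (volume : Measure V) A = ⊤ := by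
  -- A shift of length `2ρ` makes the translated balls disjoint; there are infinitely many, of equal
  -- volume.
  let τ : V := (2 * ρ / ‖ν‖) • ν
  have hν' : 0 < ‖ν‖ := norm_pos_iff.2 hν
  have hτ : ‖τ‖ = 2 * ρ := by
    rw [norm_smul, Real.norm_of_nonneg (by positivity)]
    field_simp
  have hdisj : Pairwise (Function.onFun Disjoint fun k : ℕ => ball (p + (k : ℝ) • τ) ρ) := by
    intro k l hkl
    refine ball_disjoint_ball ?_
    rw [dist_eq_norm, add_sub_add_left_eq_sub, ← sub_smul, norm_smul, hτ, Real.norm_eq_abs]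
    have h1 : (1 : ℝ) ≤ |(k : ℝ) - l| := by
      have h2 : (1 : ℤ) ≤ |(k : ℤ) - l| := Int.one_le_abs (by omega)
      exact_mod_cast h2
    nlinarith
  have hsub : (⋃ k : ℕ, ball (p + (k : ℝ) • τ) ρ) ⊆ A := by
    refine iUnion_subset fun k q hq => ?_
    have h1 : q - (k : ℝ) • τ ∈ ball p ρ := by
      rw [mem_ball, dist_eq_norm] at hq ⊢
      rwa [show q - (k : ℝ) • τ - p = q - (p + (k : ℝ) • τ) by abel]
    have h2 := h _ h1 (k * (2 * ρ / ‖ν‖)) (by positivity)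
    rwa [mul_smul, sub_add_cancel] at h2
  have hmeas : (volume : Measure V) (⋃ k : ℕ, ball (p + (k : ℝ) • τ) ρ) = ⊤ := by
    rw [measure_iUnion hdisj fun k => measurableSet_ball]
    have h1 : ∀ k : ℕ, (volume : Measure V) (ball (p + (k : ℝ) • τ) ρ)
        = (volume : Measure V) (ball 0 ρ) := fun k => Measure.addHaar_ball_center _ _ _
    simp_rw [h1]
    exact ENNReal.tsum_const_eq_top_of_ne_zero (measure_ball_pos _ _ hρ).ne'
  exact top_unique (hmeas ▸ measure_mono hsub)

/-- `H` exceeds `H p / 2` on a ball, hence on the half-infinite tube swept out along `ν`; Markov's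
inequality concludes. -/
theorem lintegral_ofReal_eq_top {H : V → ℝ} (hH : Continuous H) {ν : V} (hν : ν ≠ 0)
    (hmono : ∀ q, ∀ s : ℝ, 0 ≤ s → H q ≤ H (q + s • ν)) {p : V} (hp : 0 < H p) :
    ∫⁻ q, ENNReal.ofReal (H q) = ⊤ := by
  obtain ⟨ρ, hρ, hball⟩ := Metric.mem_nhds_iff.1
    (hH.continuousAt.eventually (lt_mem_nhds (half_lt_self hp)))
  have hA : (volume : Measure V) {q | ENNReal.ofReal (H p / 2) ≤ ENNReal.ofReal (H q)} = ⊤ := by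
    refine volume_eq_top_of_forall_ball_subset hρ hν (p := p) fun q hq s hs => ?_
    have h1 : H p / 2 < H q := hball hq
    exact ENNReal.ofReal_le_ofReal (h1.le.trans (hmono q s hs))
  have h := mul_meas_ge_le_lintegral (μ := (volume : Measure V))
    (hH.measurable.ennreal_ofReal) (ENNReal.ofReal (H p / 2))
  rw [hA, ENNReal.mul_top (by simpa using hp)] at h
  exact top_unique h

end Infinite

end Domain

/-! ### The energy: boundary control, coercivity, submodularity. -/

section Energy

variable {V : Type*} [NormedAddCommGroup V] [InnerProductSpace ℝ V] [MeasurableSpace V]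
  [BorelSpace V] [FiniteDimensional ℝ V]

/-- `g` is a continuous function on the boundary of `Ω` which is, on this boundary, the supremum of
the affine functions below it. -/
structure IsBoundaryDatum (Ω : Set V) (g : V → ℝ) : Prop where
  continuousOn : ContinuousOn g (frontier Ω)
  exists_affine : ∀ x ∈ frontier Ω, ∀ c < g x,
    ∃ p : V, c < inner ℝ p x - legendreOn (frontier Ω) g p

/-- The integral of the difference between the Legendre transforms of `w` and of its
boundary values. -/
noncomputable def legendreEnergy (Ω : Set V) (g w : V → ℝ) : ENNReal :=
  ∫⁻ p, ENNReal.ofReal (legendreOn (closure Ω) w p - legendreOn (frontier Ω) g p)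

/-- The functional whose minimiser solves the Dirichlet problem. -/
noncomputable def dirichletFunctional (Ω : Set V) (μ : Measure V) (g w : V → ℝ) : ℝ :=
  (legendreEnergy Ω g w).toReal + ∫ x in Ω, w x ∂μ

/-- The functions among which the functional is minimised. -/
structure IsCompetitor (Ω : Set V) (μ : Measure V) (g w : V → ℝ) : Prop where
  bddBelow : BddBelowOn (closure Ω) w
  bddAbove : ∃ M : ℝ, ∀ x ∈ closure Ω, w x ≤ M
  eqOn : EqOn w g (frontier Ω)
  aemeasurable : AEMeasurable w (μ.restrict Ω)
  energy_ne_top : legendreEnergy Ω g w ≠ ⊤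

variable {Ω : Set V} {μ : Measure V} {g : V → ℝ}

theorem IsBoundaryDatum.bddBelowOn (hg : IsBoundaryDatum Ω g) (hΩ : IsConvexDomain Ω) :
    BddBelowOn (frontier Ω) g :=
  hΩ.isCompact_frontier.bddBelowOn hg.continuousOn

section Nontrivial

variable [Nontrivial V]

theorem IsBoundaryDatum.continuous_legendreOn (hg : IsBoundaryDatum Ω g)
    (hΩ : IsConvexDomain Ω) : Continuous (legendreOn (frontier Ω) g) :=
  _root_.continuous_legendreOn hΩ.isCompact_frontier.isBounded hΩ.nonempty_frontier
    (hg.bddBelowOn hΩ)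

theorem legendreOn_frontier_le (hΩ : IsConvexDomain Ω) {w : V → ℝ}
    (hw : BddBelowOn (closure Ω) w) (hwg : EqOn w g (frontier Ω)) (p : V) :
    legendreOn (frontier Ω) g p ≤ legendreOn (closure Ω) w p :=
  legendreOn_mono_set hΩ.bounded_closure hΩ.nonempty_frontier frontier_subset_closure hw
    (fun _ hx => (hwg hx).le) p

/-- A function of finite energy is bounded below by its boundary values near the boundary. -/
theorem eventually_lt_of_legendreEnergy_ne_top (hΩ : IsConvexDomain Ω) (hg : IsBoundaryDatum Ω g)
    {w : V → ℝ} (hw : BddBelowOn (closure Ω) w) (hE : legendreEnergy Ω g w ≠ ⊤) {x₀ : V}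
    (hx₀ : x₀ ∈ frontier Ω) {c : ℝ} (hc : c < g x₀) : ∀ᶠ x in 𝓝[closure Ω] x₀, c < w x := by
  by_contra hcon
  obtain ⟨x, hx, hxc⟩ := exists_seq_forall_of_frequently
    ((Filter.not_eventually.1 hcon).and_eventually self_mem_nhdsWithin)
  have hgc := hg.continuous_legendreOn hΩ
  obtain ⟨p, hp⟩ := hg.exists_affine x₀ hx₀ c hc
  obtain ⟨ν, hν, hνx⟩ := hΩ.exists_normal hx₀
  -- Along the normal `ν`, `g*` grows no faster than `q·x₀`, because `x₀` maximises `ν` over the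
  -- closure.
  have htop : ∫⁻ q, ENNReal.ofReal (inner ℝ q x₀ - c - legendreOn (frontier Ω) g q) = ⊤ := by
    refine lintegral_ofReal_eq_top (by fun_prop) hν (fun q s hs => ?_) (p := p) (by linarith)
    have h1 := legendreOn_le_add_inner hΩ.isCompact_frontier.isBounded hΩ.nonempty_frontier
      (hg.bddBelowOn hΩ) (p := q) (q := s • ν) (c := s * inner ℝ ν x₀) fun y hy => by
        rw [real_inner_smul_left]
        exact mul_le_mul_of_nonneg_left (hνx y (frontier_subset_closure hy)) hs
    rw [inner_add_left, real_inner_smul_left]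
    linarith
  have hfatou := lintegral_liminf_le (μ := (volume : Measure V)) (u := (atTop : Filter ℕ))
    (f := fun k q => ENNReal.ofReal (inner ℝ q (x k) - c - legendreOn (frontier Ω) g q))
    fun k => Measurable.ennreal_ofReal (Continuous.measurable (by fun_prop))
  have hxlim : Tendsto x atTop (𝓝 x₀) := hx.mono_right nhdsWithin_le_nhds
  have hlim : ∀ q, liminf (fun k => ENNReal.ofReal
      (inner ℝ q (x k) - c - legendreOn (frontier Ω) g q)) atTop
      = ENNReal.ofReal (inner ℝ q x₀ - c - legendreOn (frontier Ω) g q) := fun q => by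
    refine Tendsto.liminf_eq ?_
    have h1 : Continuous fun y => ENNReal.ofReal (inner ℝ q y - c - legendreOn (frontier Ω) g q) :=
      ENNReal.continuous_ofReal.comp (by fun_prop)
    exact (h1.tendsto x₀).comp hxlim
  simp_rw [hlim] at hfatou
  rw [htop] at hfatou
  -- Since `w (x k) ≤ c`, testing `w*` at `x k` bounds the integrand by that of the energy; with
  -- Fatou the energy would be infinite.
  have hle : ∀ k, ∫⁻ q, ENNReal.ofReal (inner ℝ q (x k) - c - legendreOn (frontier Ω) g q)
      ≤ legendreEnergy Ω g w := fun k => by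
    refine lintegral_mono fun q => ENNReal.ofReal_le_ofReal ?_
    have h1 := inner_sub_le_legendreOn hΩ.bounded_closure hw q (hxc k).2
    have h2 := not_lt.1 (hxc k).1
    linarith
  have h2 : liminf (fun k => ∫⁻ q, ENNReal.ofReal
      (inner ℝ q (x k) - c - legendreOn (frontier Ω) g q)) atTop ≤ legendreEnergy Ω g w :=
    liminf_le_of_le (by isBoundedDefault) fun b hb => by
      obtain ⟨k, hk⟩ := hb.exists
      exact hk.trans (hle k)
  exact hE (top_unique (hfatou.trans h2))

theorem le_of_legendreEnergy_ne_top (hΩ : IsConvexDomain Ω) (hg : IsBoundaryDatum Ω g)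
    {w : V → ℝ} (hw : BddBelowOn (closure Ω) w) (hE : legendreEnergy Ω g w ≠ ⊤) {x₀ : V}
    (hx₀ : x₀ ∈ frontier Ω) : g x₀ ≤ w x₀ := by
  refine le_of_forall_lt fun c hc => ?_
  exact (eventually_lt_of_legendreEnergy_ne_top hΩ hg hw hE hx₀ hc).self_of_nhdsWithin
    (frontier_subset_closure hx₀)

theorem exists_lt_volume_ball (c : ENNReal) (hc : c ≠ ⊤) :
    ∃ r : ℕ, c < (volume : Measure V) (ball 0 r) := by
  have : NoncompactSpace V := NormedSpace.noncompactSpace ℝ V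
  have h1 : (volume : Measure V) (⋃ k : ℕ, ball (0 : V) k) = ⊤ := by
    rw [iUnion_ball_nat]
    exact measure_univ_of_isAddLeftInvariant _
  have hmono : Monotone fun k : ℕ => ball (0 : V) k := fun k l hkl =>
    ball_subset_ball (by exact_mod_cast hkl)
  rw [hmono.measure_iUnion] at h1
  exact lt_iSup_iff.1 (h1 ▸ hc.lt_top)

/-- The energy controls the infimum, with an arbitrarily small constant. -/
theorem exists_neg_le_legendreEnergy (hΩ : IsConvexDomain Ω) (hg : IsBoundaryDatum Ω g)
    {m : ℝ} (hm : 0 ≤ m) : ∃ C a : ℝ, 0 ≤ a ∧ a * m ≤ 1 / 2 ∧ ∀ w : V → ℝ,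
      BddBelowOn (closure Ω) w → legendreEnergy Ω g w ≠ ⊤ →
      ∀ x ∈ closure Ω, -w x ≤ C + a * (legendreEnergy Ω g w).toReal := by
  -- The ball has volume `v > 2m`, so that `a = 1/v` satisfies `a * m ≤ 1/2`.
  obtain ⟨r, hr⟩ := exists_lt_volume_ball (V := V) (ENNReal.ofReal (2 * m)) ENNReal.ofReal_ne_top
  obtain ⟨D, hD⟩ := hΩ.bounded_closure.exists_norm_le
  have hfin : (volume : Measure V) (ball 0 r) ≠ ⊤ := measure_ball_lt_top.ne
  set v := ((volume : Measure V) (ball 0 r)).toReal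
  have hvol : (volume : Measure V) (ball 0 r) = ENNReal.ofReal v := (ENNReal.ofReal_toReal hfin).symm
  have hv : 2 * m < v := (ENNReal.ofReal_lt_iff_lt_toReal (by linarith) hfin).1 hr
  have hv0 : 0 < v := by linarith
  refine ⟨legendreOn (frontier Ω) g 0 + 2 * D * r, v⁻¹, inv_nonneg.2 hv0.le, ?_,
    fun w hw hE x hx => ?_⟩
  · rw [inv_mul_le_iff₀ hv0]
    linarith
  have hD0 : 0 ≤ D := (norm_nonneg x).trans (hD x hx)
  -- A lower bound for `w* - g*` on the ball: one `D * r` is lost in `p·x`, another in comparing `g*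
  -- p` with `g* 0`.
  set δ := -w x - (legendreOn (frontier Ω) g 0 + 2 * D * r)
  have h1 : ∀ p ∈ ball (0 : V) r, ENNReal.ofReal δ
      ≤ ENNReal.ofReal (legendreOn (closure Ω) w p - legendreOn (frontier Ω) g p) := by
    intro p hp
    rw [mem_ball_zero_iff] at hp
    refine ENNReal.ofReal_le_ofReal ?_
    have h2 := inner_sub_le_legendreOn hΩ.bounded_closure hw p hx
    have h3 := legendreOn_le_add_norm hΩ.nonempty_frontier
      (fun y hy => hD y (frontier_subset_closure hy)) (hg.bddBelowOn hΩ) 0 p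
    rw [sub_zero] at h3
    have h4 : -(‖p‖ * ‖x‖) ≤ inner ℝ p x := (abs_le.1 (abs_real_inner_le_norm p x)).1
    have h5 : ‖p‖ * ‖x‖ ≤ D * r := by
      rw [mul_comm]
      exact mul_le_mul (hD x hx) hp.le (norm_nonneg _) hD0
    have h6 : D * ‖p‖ ≤ D * r := mul_le_mul_of_nonneg_left hp.le hD0
    simp only [δ]
    linarith
  have h2 : ENNReal.ofReal δ * (volume : Measure V) (ball 0 r) ≤ legendreEnergy Ω g w :=
    calc ENNReal.ofReal δ * (volume : Measure V) (ball 0 r)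
        = ∫⁻ _ in ball (0 : V) r, ENNReal.ofReal δ := (setLIntegral_const _ _).symm
      _ ≤ ∫⁻ p in ball (0 : V) r,
          ENNReal.ofReal (legendreOn (closure Ω) w p - legendreOn (frontier Ω) g p) :=
        setLIntegral_mono' measurableSet_ball h1
      _ ≤ legendreEnergy Ω g w := setLIntegral_le_lintegral _ _
  rw [hvol, ← ENNReal.ofReal_mul' hv0.le] at h2
  have h3 := (ENNReal.ofReal_le_iff_le_toReal hE).1 h2
  have h4 : δ ≤ v⁻¹ * (legendreEnergy Ω g w).toReal := by
    rw [inv_mul_eq_div, le_div_iff₀ hv0]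
    exact h3
  simp only [δ] at h4
  linarith

namespace IsCompetitor

variable {w v : V → ℝ}

theorem continuous_legendreOn_sub (hΩ : IsConvexDomain Ω) (hg : IsBoundaryDatum Ω g)
    (hw : IsCompetitor Ω μ g w) :
    Continuous fun p => legendreOn (closure Ω) w p - legendreOn (frontier Ω) g p :=
  (_root_.continuous_legendreOn hΩ.bounded_closure hΩ.nonempty_closure hw.bddBelow).sub
    (hg.continuous_legendreOn hΩ)

theorem legendreOn_sub_nonneg (hΩ : IsConvexDomain Ω) (hw : IsCompetitor Ω μ g w) (p : V) :
    0 ≤ legendreOn (closure Ω) w p - legendreOn (frontier Ω) g p :=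
  sub_nonneg.2 (legendreOn_frontier_le hΩ hw.bddBelow hw.eqOn p)

theorem integrable_legendreOn_sub (hΩ : IsConvexDomain Ω) (hg : IsBoundaryDatum Ω g)
    (hw : IsCompetitor Ω μ g w) :
    Integrable fun p => legendreOn (closure Ω) w p - legendreOn (frontier Ω) g p := by
  refine ⟨(hw.continuous_legendreOn_sub hΩ hg).aestronglyMeasurable, ?_⟩
  rw [hasFiniteIntegral_iff_ofReal (Eventually.of_forall (hw.legendreOn_sub_nonneg hΩ))]
  exact hw.energy_ne_top.lt_top

theorem toReal_legendreEnergy (hΩ : IsConvexDomain Ω) (hg : IsBoundaryDatum Ω g)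
    (hw : IsCompetitor Ω μ g w) : (legendreEnergy Ω g w).toReal
      = ∫ p, (legendreOn (closure Ω) w p - legendreOn (frontier Ω) g p) :=
  (integral_eq_lintegral_of_nonneg_ae (Eventually.of_forall (hw.legendreOn_sub_nonneg hΩ))
    (hw.continuous_legendreOn_sub hΩ hg).aestronglyMeasurable).symm

omit [BorelSpace V] [FiniteDimensional ℝ V] [Nontrivial V] in
theorem integrableOn_of_bounds [OpensMeasurableSpace V] (hΩ : IsConvexDomain Ω) (hμ : μ Ω < ⊤)
    (hm : AEMeasurable w (μ.restrict Ω)) {a b : ℝ} (h : ∀ x ∈ Ω, a ≤ w x ∧ w x ≤ b) :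
    IntegrableOn w Ω μ := by
  have : IsFiniteMeasure (μ.restrict Ω) := ⟨by simpa using hμ⟩
  refine Integrable.of_bound hm.aestronglyMeasurable (max |a| |b|) ?_
  filter_upwards [ae_restrict_mem hΩ.isOpen.measurableSet] with x hx
  exact abs_le_max_abs_abs (h x hx).1 (h x hx).2

theorem integrableOn (hΩ : IsConvexDomain Ω) (hμ : μ Ω < ⊤) (hw : IsCompetitor Ω μ g w) :
    IntegrableOn w Ω μ := by
  obtain ⟨a, ha⟩ := hw.bddBelow
  obtain ⟨b, hb⟩ := hw.bddAbove
  exact integrableOn_of_bounds hΩ hμ hw.aemeasurable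
    fun x hx => ⟨ha x (subset_closure hx), hb x (subset_closure hx)⟩

theorem sup (hΩ : IsConvexDomain Ω) (hw : IsCompetitor Ω μ g w) (hv : IsCompetitor Ω μ g v) :
    IsCompetitor Ω μ g (w ⊔ v) where
  bddBelow := hw.bddBelow.of_le fun x _ => le_max_left _ _
  bddAbove := by
    obtain ⟨a, ha⟩ := hw.bddAbove
    obtain ⟨b, hb⟩ := hv.bddAbove
    exact ⟨max a b, fun x hx => max_le_max (ha x hx) (hb x hx)⟩
  eqOn x hx := by simp [hw.eqOn hx, hv.eqOn hx]
  aemeasurable := hw.aemeasurable.sup hv.aemeasurable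
  energy_ne_top := ne_top_of_le_ne_top hw.energy_ne_top <| lintegral_mono fun p =>
    ENNReal.ofReal_le_ofReal <| sub_le_sub_right (legendreOn_anti hΩ.bounded_closure
      hΩ.nonempty_closure hw.bddBelow (fun x _ => le_max_left _ _) p) _

theorem inf (hΩ : IsConvexDomain Ω) (hg : IsBoundaryDatum Ω g) (hw : IsCompetitor Ω μ g w)
    (hv : IsCompetitor Ω μ g v) : IsCompetitor Ω μ g (w ⊓ v) where
  bddBelow := by
    obtain ⟨a, ha⟩ := hw.bddBelow
    obtain ⟨b, hb⟩ := hv.bddBelow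
    exact ⟨min a b, fun x hx => min_le_min (ha x hx) (hb x hx)⟩
  bddAbove := by
    obtain ⟨a, ha⟩ := hw.bddAbove
    exact ⟨a, fun x hx => (min_le_left _ _).trans (ha x hx)⟩
  eqOn x hx := by simp [hw.eqOn hx, hv.eqOn hx]
  aemeasurable := hw.aemeasurable.inf hv.aemeasurable
  energy_ne_top := by
    refine ne_top_of_le_ne_top (ENNReal.add_ne_top.2 ⟨hw.energy_ne_top, hv.energy_ne_top⟩) ?_
    unfold legendreEnergy
    rw [← lintegral_add_left (hw.continuous_legendreOn_sub hΩ hg).measurable.ennreal_ofReal]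
    refine lintegral_mono fun p => ?_
    rw [← ENNReal.ofReal_add (hw.legendreOn_sub_nonneg hΩ p) (hv.legendreOn_sub_nonneg hΩ p)]
    refine ENNReal.ofReal_le_ofReal ?_
    have h1 := legendreOn_inf_le hΩ.bounded_closure hΩ.nonempty_closure hw.bddBelow hv.bddBelow p
    have h2 := hw.legendreOn_sub_nonneg hΩ p
    have h3 := hv.legendreOn_sub_nonneg hΩ p
    rcases max_cases (legendreOn (closure Ω) w p) (legendreOn (closure Ω) v p) with h | h <;>
      linarith

/-- Pointwise in `p`, the transform of the infimum is at most the larger of the two transforms and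
that of the supremum at most the smaller. The `μ`-integrals add up exactly. -/
theorem dirichletFunctional_sup_add_inf_le (hΩ : IsConvexDomain Ω) (hμ : μ Ω < ⊤)
    (hg : IsBoundaryDatum Ω g) (hw : IsCompetitor Ω μ g w) (hv : IsCompetitor Ω μ g v) :
    dirichletFunctional Ω μ g (w ⊔ v) + dirichletFunctional Ω μ g (w ⊓ v)
      ≤ dirichletFunctional Ω μ g w + dirichletFunctional Ω μ g v := by
  have hs := hw.sup hΩ hv
  have hi := hw.inf hΩ hg hv
  unfold dirichletFunctional
  rw [hs.toReal_legendreEnergy hΩ hg, hi.toReal_legendreEnergy hΩ hg,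
    hw.toReal_legendreEnergy hΩ hg, hv.toReal_legendreEnergy hΩ hg]
  have h1 : (∫ x in Ω, (w ⊔ v) x ∂μ) + ∫ x in Ω, (w ⊓ v) x ∂μ
      = (∫ x in Ω, w x ∂μ) + ∫ x in Ω, v x ∂μ := by
    rw [← integral_add (hs.integrableOn hΩ hμ) (hi.integrableOn hΩ hμ),
      ← integral_add (hw.integrableOn hΩ hμ) (hv.integrableOn hΩ hμ)]
    exact integral_congr_ae (Eventually.of_forall fun x => max_add_min (w x) (v x))
  have h2 : (∫ p, (legendreOn (closure Ω) (w ⊔ v) p - legendreOn (frontier Ω) g p))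
      + ∫ p, (legendreOn (closure Ω) (w ⊓ v) p - legendreOn (frontier Ω) g p)
      ≤ (∫ p, (legendreOn (closure Ω) w p - legendreOn (frontier Ω) g p))
      + ∫ p, (legendreOn (closure Ω) v p - legendreOn (frontier Ω) g p) := by
    rw [← integral_add (hs.integrable_legendreOn_sub hΩ hg) (hi.integrable_legendreOn_sub hΩ hg),
      ← integral_add (hw.integrable_legendreOn_sub hΩ hg) (hv.integrable_legendreOn_sub hΩ hg)]
    refine integral_mono
      ((hs.integrable_legendreOn_sub hΩ hg).add (hi.integrable_legendreOn_sub hΩ hg))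
      ((hw.integrable_legendreOn_sub hΩ hg).add (hv.integrable_legendreOn_sub hΩ hg)) fun p => ?_
    have h1 := legendreOn_inf_le hΩ.bounded_closure hΩ.nonempty_closure hw.bddBelow hv.bddBelow p
    have h2 := legendreOn_anti hΩ.bounded_closure hΩ.nonempty_closure hw.bddBelow
      (v := w ⊔ v) (fun x _ => le_max_left _ _) p
    have h3 := legendreOn_anti hΩ.bounded_closure hΩ.nonempty_closure hv.bddBelow
      (v := w ⊔ v) (fun x _ => le_max_right _ _) p
    show _ + _ ≤ _ + _
    rcases max_cases (legendreOn (closure Ω) w p) (legendreOn (closure Ω) v p) with h | h <;>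
      linarith
  linarith

end IsCompetitor

/-- The functional is coercive. -/
theorem exists_legendreEnergy_le (hΩ : IsConvexDomain Ω) (hμ : μ Ω < ⊤)
    (hg : IsBoundaryDatum Ω g) : ∃ C : ℝ, ∀ w, IsCompetitor Ω μ g w →
      (legendreEnergy Ω g w).toReal / 2 - C ≤ dirichletFunctional Ω μ g w := by
  set m := μ.real Ω
  -- With `m` the mass of `Ω`, the loss in the `μ`-integral is at most half the energy plus a
  -- constant.
  obtain ⟨C, a, ha, ham, h⟩ := exists_neg_le_legendreEnergy hΩ hg (m := m) ENNReal.toReal_nonneg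
  refine ⟨C * m, fun w hw => ?_⟩
  set e := (legendreEnergy Ω g w).toReal
  have he : 0 ≤ e := ENNReal.toReal_nonneg
  have h1 : ∫ _ in Ω, (-(C + a * e)) ∂μ ≤ ∫ x in Ω, w x ∂μ := by
    refine setIntegral_mono_on (integrableOn_const hμ.ne) (hw.integrableOn hΩ hμ)
      hΩ.isOpen.measurableSet fun x hx => ?_
    have := h w hw.bddBelow hw.energy_ne_top x (subset_closure hx)
    linarith
  rw [setIntegral_const, smul_eq_mul] at h1
  have h2 : a * m * e ≤ 1 / 2 * e := mul_le_mul_of_nonneg_right ham he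
  have h3 : μ.real Ω * -(C + a * e) = -(C * m) - a * m * e := by
    simp only [m]
    ring
  show _ ≤ e + ∫ x in Ω, w x ∂μ
  linarith

end Nontrivial

end Energy

/-! ### Existence of a convex continuous minimiser. -/

section Minimizer

variable {V : Type*} [NormedAddCommGroup V] [InnerProductSpace ℝ V] [MeasurableSpace V]
  [BorelSpace V] [FiniteDimensional ℝ V] [Nontrivial V]

variable {Ω : Set V} {μ : Measure V} {g : V → ℝ}

/-- There is a competitor, equal to a large constant in the interior, whose energy vanishes. -/
theorem exists_isCompetitor_le (hΩ : IsConvexDomain Ω) (hg : IsBoundaryDatum Ω g) :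
    ∃ M : ℝ, ∃ w, IsCompetitor Ω μ g w ∧ (∀ x ∈ closure Ω, w x ≤ M) ∧
      ∀ p, legendreOn (closure Ω) w p ≤ legendreOn (frontier Ω) g p := by
  classical
  obtain ⟨M, hM⟩ := hΩ.isCompact_frontier.bddAbove_image hg.continuousOn
  replace hM : ∀ x ∈ frontier Ω, g x ≤ M := fun x hx => hM (mem_image_of_mem g hx)
  obtain ⟨m, hm⟩ := hg.bddBelowOn hΩ
  let w : V → ℝ := fun x => if x ∈ frontier Ω then g x else M
  have hwf : ∀ x ∈ frontier Ω, w x = g x := fun x hx => if_pos hx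
  have hwn : ∀ x, x ∉ frontier Ω → w x = M := fun x hx => if_neg hx
  have hw : ∀ x ∈ closure Ω, min m M ≤ w x := fun x hx => by
    by_cases h : x ∈ frontier Ω
    · rw [hwf x h]
      exact (min_le_left _ _).trans (hm x h)
    · rw [hwn x h]
      exact min_le_right _ _
  have hwM : ∀ x ∈ closure Ω, w x ≤ M := fun x hx => by
    by_cases h : x ∈ frontier Ω
    · rw [hwf x h]
      exact hM x h
    · rw [hwn x h]
  have hL : ∀ p, legendreOn (closure Ω) w p ≤ legendreOn (frontier Ω) g p := fun p => by
    refine legendreOn_le hΩ.nonempty_closure fun x hx => ?_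
    have key : ∀ y ∈ frontier Ω, inner ℝ p y - g y ≤ legendreOn (frontier Ω) g p :=
      fun y hy => inner_sub_le_legendreOn hΩ.isCompact_frontier.isBounded (hg.bddBelowOn hΩ) p hy
    by_cases h : x ∈ frontier Ω
    · rw [hwf x h]
      exact key x h
    · rw [hwn x h]
      obtain ⟨y, hy, hxy⟩ := hΩ.exists_mem_frontier_inner_le hx p
      have h1 := key y hy
      have h2 := hM y hy
      linarith
  refine ⟨M, w, ⟨⟨_, hw⟩, ⟨M, hwM⟩, hwf, ?_, ?_⟩, hwM, hL⟩
  · refine (aemeasurable_const (b := M)).congr ?_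
    filter_upwards [ae_restrict_mem hΩ.isOpen.measurableSet] with x hx
    exact (hwn x fun h => hΩ.notMem_of_mem_frontier h hx).symm
  · have : legendreEnergy Ω g w = 0 := (lintegral_congr fun p =>
      ENNReal.ofReal_of_nonpos (sub_nonpos.2 (hL p))).trans lintegral_zero
    rw [this]
    exact ENNReal.zero_ne_top

/-- Passing to the supremum only lowers the energy; the `μ`-integral converges by monotone
convergence, the bound `M` keeping the limit finite. -/
theorem dirichletFunctional_iSup_le (hΩ : IsConvexDomain Ω) (hμ : μ Ω < ⊤)
    {M a : ℝ} {w : ℕ → V → ℝ} (hw : ∀ k, IsCompetitor Ω μ g (w k))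
    (hwM : ∀ k, ∀ x ∈ closure Ω, w k x ≤ M) (hmono : Monotone w)
    (ha : ∀ k, dirichletFunctional Ω μ g (w k) ≤ a) :
    IsCompetitor Ω μ g (fun x => ⨆ k, w k x) ∧ (∀ x ∈ closure Ω, ⨆ k, w k x ≤ M) ∧
      dirichletFunctional Ω μ g (fun x => ⨆ k, w k x) ≤ a := by
  have hbdd : ∀ x ∈ closure Ω, BddAbove (range fun k => w k x) := fun x hx =>
    ⟨M, by rintro _ ⟨k, rfl⟩; exact hwM k x hx⟩
  have hle : ∀ k, ∀ x ∈ closure Ω, w k x ≤ ⨆ k, w k x := fun k x hx => le_ciSup (hbdd x hx) k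
  have hM : ∀ x ∈ closure Ω, ⨆ k, w k x ≤ M := fun x hx => ciSup_le fun k => hwM k x hx
  have hE : ∀ k, legendreEnergy Ω g (fun x => ⨆ k, w k x) ≤ legendreEnergy Ω g (w k) := fun k =>
    lintegral_mono fun p => ENNReal.ofReal_le_ofReal <| sub_le_sub_right
      (legendreOn_anti hΩ.bounded_closure hΩ.nonempty_closure (hw k).bddBelow (hle k) p) _
  have hc : IsCompetitor Ω μ g (fun x => ⨆ k, w k x) :=
    { bddBelow := (hw 0).bddBelow.of_le (hle 0)
      bddAbove := ⟨M, hM⟩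
      eqOn := fun x hx => by
        show ⨆ k, w k x = g x
        simp [fun k => (hw k).eqOn hx]
      aemeasurable := AEMeasurable.iSup fun k => (hw k).aemeasurable
      energy_ne_top := ne_top_of_le_ne_top (hw 0).energy_ne_top (hE 0) }
  refine ⟨hc, hM, ?_⟩
  have hlim : Tendsto (fun k => ∫ x in Ω, w k x ∂μ) atTop (𝓝 (∫ x in Ω, ⨆ k, w k x ∂μ)) := by
    refine integral_tendsto_of_tendsto_of_monotone (fun k => (hw k).integrableOn hΩ hμ)
      (hc.integrableOn hΩ hμ) (Eventually.of_forall fun x k l hkl => hmono hkl x) ?_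
    filter_upwards [ae_restrict_mem hΩ.isOpen.measurableSet] with x hx
    exact tendsto_atTop_ciSup (fun k l hkl => hmono hkl x) (hbdd x (subset_closure hx))
  refine le_of_tendsto (tendsto_const_nhds.add hlim) (Eventually.of_forall fun k => ?_)
  have h1 := ENNReal.toReal_mono (hw k).energy_ne_top (hE k)
  have h2 := ha k
  unfold dirichletFunctional at h2
  linarith

/-- Coercivity bounds the energies, hence the functions from below uniformly. The transform of the
infimum is the supremum of the transforms, so monotone convergence applies to both terms. -/
theorem dirichletFunctional_iInf_le (hΩ : IsConvexDomain Ω) (hμ : μ Ω < ⊤)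
    (hg : IsBoundaryDatum Ω g) {M c : ℝ} {a : ℕ → ℝ} {v : ℕ → V → ℝ}
    (hv : ∀ k, IsCompetitor Ω μ g (v k)) (hvM : ∀ k, ∀ x ∈ closure Ω, v k x ≤ M)
    (hanti : ∀ x ∈ closure Ω, Antitone fun k => v k x)
    (ha : ∀ k, dirichletFunctional Ω μ g (v k) ≤ a k) (hac : Tendsto a atTop (𝓝 c)) :
    IsCompetitor Ω μ g (fun x => ⨅ k, v k x) ∧ (∀ x ∈ closure Ω, ⨅ k, v k x ≤ M) ∧
      dirichletFunctional Ω μ g (fun x => ⨅ k, v k x) ≤ c := by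
  obtain ⟨C, hC⟩ := exists_legendreEnergy_le (μ := μ) hΩ hμ hg
  obtain ⟨A, hA⟩ := hac.bddAbove_range
  replace hA : ∀ k, a k ≤ A := fun k => hA (mem_range_self k)
  set B := 2 * (A + C)
  have hEB : ∀ k, (legendreEnergy Ω g (v k)).toReal ≤ B := fun k => by
    have h1 := hC _ (hv k)
    have h2 := ha k
    have h3 := hA k
    simp only [B]
    linarith
  obtain ⟨C', b, hb, -, hlow⟩ := exists_neg_le_legendreEnergy hΩ hg le_rfl
  have hbelow : ∀ k, ∀ x ∈ closure Ω, -(C' + b * B) ≤ v k x := fun k x hx => by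
    have h1 := hlow _ (hv k).bddBelow (hv k).energy_ne_top x hx
    have h2 := mul_le_mul_of_nonneg_left (hEB k) hb
    linarith
  have hbdd : ∀ x ∈ closure Ω, BddBelow (range fun k => v k x) := fun x hx =>
    ⟨_, by rintro _ ⟨k, rfl⟩; exact hbelow k x hx⟩
  have hle : ∀ k, ∀ x ∈ closure Ω, ⨅ k, v k x ≤ v k x := fun k x hx => ciInf_le (hbdd x hx) k
  have hub : BddBelowOn (closure Ω) (fun x => ⨅ k, v k x) :=
    ⟨_, fun x hx => le_ciInf fun k => hbelow k x hx⟩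
  have hmonoL : ∀ p, Monotone fun k => legendreOn (closure Ω) (v k) p := fun p k l hkl =>
    legendreOn_anti hΩ.bounded_closure hΩ.nonempty_closure (hv l).bddBelow
      (fun x hx => hanti x hx hkl) p
  have hlub : ∀ p, IsLUB (range fun k => legendreOn (closure Ω) (v k) p)
      (legendreOn (closure Ω) (fun x => ⨅ k, v k x) p) := fun p => by
    constructor
    · rintro _ ⟨k, rfl⟩
      exact legendreOn_anti hΩ.bounded_closure hΩ.nonempty_closure hub (hle k) p
    · intro β hβ
      refine legendreOn_le hΩ.nonempty_closure fun x hx => ?_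
      have h1 : inner ℝ p x - β ≤ ⨅ k, v k x := le_ciInf fun k => by
        have h2 := inner_sub_le_legendreOn hΩ.bounded_closure (hv k).bddBelow p hx
        have h3 := hβ (mem_range_self k)
        linarith
      linarith
  have hEt : Tendsto (fun k => legendreEnergy Ω g (v k)) atTop
      (𝓝 (legendreEnergy Ω g fun x => ⨅ k, v k x)) := by
    refine lintegral_tendsto_of_tendsto_of_monotone
      (fun k => ((hv k).continuous_legendreOn_sub hΩ hg).measurable.ennreal_ofReal.aemeasurable)
      (Eventually.of_forall fun p k l hkl =>
        ENNReal.ofReal_le_ofReal (sub_le_sub_right (hmonoL p hkl) _))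
      (Eventually.of_forall fun p => ?_)
    exact (ENNReal.continuous_ofReal.tendsto _).comp
      ((tendsto_atTop_isLUB (hmonoL p) (hlub p)).sub_const _)
  have hE : legendreEnergy Ω g (fun x => ⨅ k, v k x) ≠ ⊤ := by
    refine ne_top_of_le_ne_top (ENNReal.ofReal_ne_top (r := B))
      (le_of_tendsto hEt (Eventually.of_forall fun k => ?_))
    exact (ENNReal.le_ofReal_iff_toReal_le (hv k).energy_ne_top
      (ENNReal.toReal_nonneg.trans (hEB k))).2 (hEB k)
  have hM : ∀ x ∈ closure Ω, ⨅ k, v k x ≤ M := fun x hx => (hle 0 x hx).trans (hvM 0 x hx)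
  have hc : IsCompetitor Ω μ g (fun x => ⨅ k, v k x) :=
    { bddBelow := hub
      bddAbove := ⟨M, hM⟩
      eqOn := fun x hx => by
        show ⨅ k, v k x = g x
        simp [fun k => (hv k).eqOn hx]
      aemeasurable := AEMeasurable.iInf fun k => (hv k).aemeasurable
      energy_ne_top := hE }
  refine ⟨hc, hM, ?_⟩
  have hlim : Tendsto (fun k => ∫ x in Ω, v k x ∂μ) atTop (𝓝 (∫ x in Ω, ⨅ k, v k x ∂μ)) := by
    refine integral_tendsto_of_tendsto_of_antitone (fun k => (hv k).integrableOn hΩ hμ)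
      (hc.integrableOn hΩ hμ) ?_ ?_ <;>
      filter_upwards [ae_restrict_mem hΩ.isOpen.measurableSet] with x hx
    · exact hanti x (subset_closure hx)
    · exact tendsto_atTop_ciInf (hanti x (subset_closure hx)) (hbdd x (subset_closure hx))
  exact le_of_tendsto_of_tendsto' (((ENNReal.tendsto_toReal hE).comp hEt).add hlim) hac ha

/-- The functional attains its minimum among the competitors bounded by `M`. -/
theorem exists_minimizer_of_le (hΩ : IsConvexDomain Ω) (hμ : μ Ω < ⊤) (hg : IsBoundaryDatum Ω g)
    {M : ℝ} (hne : ∃ w, IsCompetitor Ω μ g w ∧ ∀ x ∈ closure Ω, w x ≤ M) :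
    ∃ u, IsCompetitor Ω μ g u ∧ (∀ x ∈ closure Ω, u x ≤ M) ∧ ∀ w, IsCompetitor Ω μ g w →
      (∀ x ∈ closure Ω, w x ≤ M) → dirichletFunctional Ω μ g u ≤ dirichletFunctional Ω μ g w := by
  set 𝒜 : Set (V → ℝ) := {w | IsCompetitor Ω μ g w ∧ ∀ x ∈ closure Ω, w x ≤ M}
  set J := dirichletFunctional Ω μ g
  obtain ⟨C, hC⟩ := exists_legendreEnergy_le (μ := μ) hΩ hμ hg
  have hbdd : BddBelow (J '' 𝒜) := by
    refine ⟨-C, ?_⟩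
    rintro _ ⟨w, hw, rfl⟩
    have h1 := hC w hw.1
    have h2 : 0 ≤ (legendreEnergy Ω g w).toReal := ENNReal.toReal_nonneg
    show -C ≤ dirichletFunctional Ω μ g w
    linarith
  set c := sInf (J '' 𝒜)
  have hcle : ∀ w ∈ 𝒜, c ≤ J w := fun w hw => csInf_le hbdd (mem_image_of_mem J hw)
  have hseq : ∀ k : ℕ, ∃ u ∈ 𝒜, J u ≤ c + (1 / 2) ^ k := fun k => by
    have hlt : c < c + (1 / 2 : ℝ) ^ k := lt_add_of_pos_right _ (by positivity)
    obtain ⟨_, ⟨u, hu, rfl⟩, h⟩ := exists_lt_of_csInf_lt (Set.Nonempty.image J hne) hlt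
    exact ⟨u, hu, h.le⟩
  choose u hu hJ using hseq
  -- `W j m` is the maximum of `u j, …, u (j + m)`; the minimiser will be the upper limit of `u`,
  -- reached as an increasing limit in `m` and then a decreasing one in `j`.
  let W : ℕ → ℕ → V → ℝ := fun j m => partialSups (fun k => u (j + k)) m
  have hW0 : ∀ j, W j 0 = u j := fun j => by simp [W]
  have hWs : ∀ j m, W j (m + 1) = W j m ⊔ u (j + (m + 1)) := fun j m =>
    partialSups_add_one (fun k => u (j + k)) m
  -- The minimum in the submodularity inequality is admissible, so its value is at least `c` and the
  -- excesses over `c` add: the bound is a geometric sum.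
  have hW : ∀ j m, W j m ∈ 𝒜 ∧ J (W j m) ≤ c + 2 * (1 / 2) ^ j - (1 / 2) ^ (j + m) := by
    intro j m
    induction m with
    | zero =>
      rw [hW0]
      refine ⟨hu j, ?_⟩
      have := hJ j
      rw [add_zero]
      linarith
    | succ m ih =>
      have hu' := hu (j + (m + 1))
      rw [hWs]
      refine ⟨⟨ih.1.1.sup hΩ hu'.1, fun x hx => max_le (ih.1.2 x hx) (hu'.2 x hx)⟩, ?_⟩
      have h1 := ih.1.1.dirichletFunctional_sup_add_inf_le hΩ hμ hg hu'.1
      have h2 := hcle (W j m ⊓ u (j + (m + 1)))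
        ⟨ih.1.1.inf hΩ hg hu'.1, fun x hx => (min_le_left _ _).trans (ih.1.2 x hx)⟩
      have h3 := hJ (j + (m + 1))
      have h4 := ih.2
      have h5 : (1 / 2 : ℝ) ^ (j + m) = 2 * (1 / 2) ^ (j + (m + 1)) := by
        rw [← add_assoc, pow_succ]
        ring
      change J (W j m ⊔ u (j + (m + 1))) + J (W j m ⊓ u (j + (m + 1)))
        ≤ J (W j m) + J (u (j + (m + 1))) at h1
      linarith
  have hV := fun j => dirichletFunctional_iSup_le hΩ hμ (a := c + 2 * (1 / 2) ^ j)
    (fun m => (hW j m).1.1) (fun m => (hW j m).1.2) (partialSups_monotone _) fun m => by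
      have h1 := (hW j m).2
      have h2 : (0 : ℝ) ≤ (1 / 2) ^ (j + m) := by positivity
      show J (W j m) ≤ _
      linarith
  have hanti : ∀ x ∈ closure Ω, Antitone fun j => ⨆ m, W j m x := fun x hx =>
    antitone_nat_of_succ_le fun j => ciSup_le fun m => by
      have h1 : W (j + 1) m ≤ W j (m + 1) := partialSups_le _ _ _ fun i hi => by
        have h2 := le_partialSups_of_le (fun k => u (j + k)) (Nat.succ_le_succ hi)
        rwa [show j + 1 + i = j + i.succ by omega]
      refine (h1 x).trans (le_ciSup (f := fun m => W j m x) ⟨M, ?_⟩ (m + 1))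
      rintro _ ⟨k, rfl⟩
      exact (hW j k).1.2 x hx
  have hac : Tendsto (fun j : ℕ => c + 2 * (1 / 2 : ℝ) ^ j) atTop (𝓝 c) := by
    have h1 := (tendsto_pow_atTop_nhds_zero_of_lt_one (r := (1 / 2 : ℝ)) (by norm_num)
      (by norm_num)).const_mul 2 |>.const_add c
    simpa using h1
  obtain ⟨h1, h2, h3⟩ := dirichletFunctional_iInf_le hΩ hμ hg (fun j => (hV j).1)
    (fun j => (hV j).2.1) hanti (fun j => (hV j).2.2) hac
  exact ⟨_, h1, h2, fun w hw hwM => h3.trans (hcle w ⟨hw, hwM⟩)⟩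

/-- The functional has a continuous convex minimiser. -/
theorem exists_minimizer (hΩ : IsConvexDomain Ω) (hμ : μ Ω < ⊤) (hg : IsBoundaryDatum Ω g) :
    ∃ u, IsCompetitor Ω μ g u ∧ ContinuousOn u (closure Ω) ∧ ConvexOn ℝ (closure Ω) u ∧
      ∀ w, IsCompetitor Ω μ g w → dirichletFunctional Ω μ g u ≤ dirichletFunctional Ω μ g w := by
  obtain ⟨M, w₀, hw₀, hw₀M, hw₀L⟩ := exists_isCompetitor_le (μ := μ) hΩ hg
  obtain ⟨u, hu, huM, hmin⟩ := exists_minimizer_of_le hΩ hμ hg ⟨w₀, hw₀, hw₀M⟩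
  have hb := hΩ.bounded_closure
  have hne := hΩ.nonempty_closure
  set v := biconjOn (closure Ω) u
  have hvb : BddBelowOn (closure Ω) v := bddBelowOn_biconjOn hb hu.bddBelow
  have hvle : ∀ x ∈ closure Ω, v x ≤ u x := fun x hx => biconjOn_le hb hu.bddBelow hx
  have hvL : legendreOn (closure Ω) v = legendreOn (closure Ω) u :=
    legendreOn_biconjOn hb hu.bddBelow hne
  have hEv : legendreEnergy Ω g v = legendreEnergy Ω g u := by
    unfold legendreEnergy
    rw [hvL]
  have hEt : legendreEnergy Ω g v ≠ ⊤ := hEv ▸ hu.energy_ne_top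
  have hvc : ConvexOn ℝ (closure Ω) v := convexOn_biconjOn hb hu.bddBelow hΩ.convex.closure
  -- The envelope could fall below `g` on the boundary; its finite energy prevents this.
  have hvg : EqOn v g (frontier Ω) := fun x hx => le_antisymm
    ((hvle x (frontier_subset_closure hx)).trans (hu.eqOn hx).le)
    (le_of_legendreEnergy_ne_top hΩ hg hvb hEt hx)
  have hvcont : ContinuousOn v (closure Ω) := by
    intro x hx
    by_cases hxf : x ∈ frontier Ω
    · refine tendsto_order.2 ⟨fun c hc => ?_, fun c hc => ?_⟩
      · exact eventually_lt_of_legendreEnergy_ne_top hΩ hg hvb hEt hxf (hvg hxf ▸ hc)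
      · exact hΩ.eventually_lt_of_convexOn hvc hg.continuousOn hvg hxf (hvg hxf ▸ hc)
    · have hxΩ : x ∈ Ω := by
        by_contra h
        exact hxf (hΩ.mem_frontier hx h)
      have h1 : ContinuousOn v Ω :=
        (hvc.subset subset_closure hΩ.convex).continuousOn hΩ.isOpen
      exact (h1.continuousAt (hΩ.isOpen.mem_nhds hxΩ)).continuousWithinAt
  have hv : IsCompetitor Ω μ g v :=
    { bddBelow := hvb
      bddAbove := ⟨M, fun x hx => (hvle x hx).trans (huM x hx)⟩
      eqOn := hvg
      aemeasurable := (hvcont.mono subset_closure).aemeasurable hΩ.isOpen.measurableSet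
      energy_ne_top := hEt }
  have hvu : dirichletFunctional Ω μ g v ≤ dirichletFunctional Ω μ g u := by
    unfold dirichletFunctional
    rw [hEv]
    gcongr 1
    exact setIntegral_mono_on (hv.integrableOn hΩ hμ) (hu.integrableOn hΩ hμ)
      hΩ.isOpen.measurableSet fun x hx => hvle x (subset_closure hx)
  refine ⟨v, hv, hvcont, hvc, fun w hw => hvu.trans ?_⟩
  -- Truncating by `w₀` removes the bound `M` on competitors: the energy does not rise because `w₀*
  -- ≤ g* ≤ w*`.
  have hi : IsCompetitor Ω μ g (w ⊓ w₀) := hw.inf hΩ hg hw₀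
  refine (hmin _ hi fun x hx => (min_le_right _ _).trans (hw₀M x hx)).trans ?_
  have hE : legendreEnergy Ω g (w ⊓ w₀) ≤ legendreEnergy Ω g w :=
    lintegral_mono fun p => ENNReal.ofReal_le_ofReal <| sub_le_sub_right
      ((legendreOn_inf_le hb hne hw.bddBelow hw₀.bddBelow p).trans <| max_le le_rfl <|
        (hw₀L p).trans (legendreOn_frontier_le hΩ hw.bddBelow hw.eqOn p)) _
  exact add_le_add (ENNReal.toReal_mono hw.energy_ne_top hE)
    (setIntegral_mono_on (hi.integrableOn hΩ hμ) (hw.integrableOn hΩ hμ)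
      hΩ.isOpen.measurableSet fun x _ => min_le_left _ _)

end Minimizer

/-! ### First variation and Euler–Lagrange equation. -/

section Variation

variable {V : Type*} [NormedAddCommGroup V] [InnerProductSpace ℝ V]

/-- The directional derivative of the Legendre transform, at a point of differentiability. -/
theorem tendsto_legendreOn_perturb [CompleteSpace V] {K : Set V} (hK : IsCompact K)
    (hne : K.Nonempty)
    {u φ : V → ℝ} (hu : ContinuousOn u K) (hφ : Continuous φ) (hφ1 : ∀ x, |φ x| ≤ 1) {p : V}
    (hd : DifferentiableAt ℝ (legendreOn K u) p) {t : ℕ → ℝ} (ht : Tendsto t atTop (𝓝 0))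
    (ht0 : ∀ k, t k ≠ 0) :
    Tendsto (fun k => (legendreOn K (fun x => u x + t k * φ x) p - legendreOn K u p) / t k) atTop
      (𝓝 (-φ (gradient (legendreOn K u) p))) := by
  have hb := hK.isBounded
  have hub := hK.bddBelowOn hu
  obtain ⟨X, hX, hXmax⟩ := exists_legendreOn_eq hK hne hu p
  rw [gradient_legendreOn_eq hb hub hd hX hXmax]
  have hwc : ∀ k, ContinuousOn (fun x => u x + t k * φ x) K := fun k =>
    hu.add (by fun_prop)
  choose x hx hxmax using fun k => exists_legendreOn_eq hK hne (hwc k) p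
  have hlow : ∀ k, legendreOn K u p - 2 * |t k| ≤ inner ℝ p (x k) - u (x k) := fun k => by
    have h1 := inner_sub_le_legendreOn hb (hK.bddBelowOn (hwc k)) p hX
    rw [hxmax k] at h1
    have h2 : ∀ y, |t k * φ y| ≤ |t k| := fun y => by
      rw [abs_mul]
      exact mul_le_of_le_one_right (abs_nonneg _) (hφ1 y)
    have h3 := abs_le.1 (h2 X)
    have h4 := abs_le.1 (h2 (x k))
    linarith
  -- A cluster point of the perturbed maximisers maximises the unperturbed problem, hence equals the
  -- gradient `X`.
  have hxlim : Tendsto x atTop (𝓝 X) := by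
    refine tendsto_of_subseq_tendsto fun ns hns => ?_
    obtain ⟨y, hy, ms, hms, hlim⟩ := hK.tendsto_subseq fun k => hx (ns k)
    refine ⟨ms, ?_⟩
    suffices h : y = X by
      rw [← h]
      exact hlim
    have hsub : Tendsto (fun k => ns (ms k)) atTop atTop := hns.comp hms.tendsto_atTop
    have h1 : Tendsto (fun k => legendreOn K u p - 2 * |t (ns (ms k))|) atTop
        (𝓝 (legendreOn K u p)) := by
      have := ((ht.comp hsub).abs.const_mul 2).const_sub (legendreOn K u p)
      simpa using this
    have h2 : Tendsto (fun k => inner ℝ p (x (ns (ms k))) - u (x (ns (ms k)))) atTop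
        (𝓝 (inner ℝ p y - u y)) := by
      have hc : ContinuousOn (fun z => inner ℝ p z - u z) K := by fun_prop
      exact (hc y hy).tendsto.comp
        (tendsto_nhdsWithin_iff.2 ⟨hlim, Eventually.of_forall fun k => hx (ns (ms k))⟩)
    have h3 : legendreOn K u p ≤ inner ℝ p y - u y :=
      le_of_tendsto_of_tendsto' h1 h2 fun k => hlow _
    have h4 := h3.antisymm (inner_sub_le_legendreOn hb hub p hy)
    rw [← gradient_legendreOn_eq hb hub hd hy h4, ← gradient_legendreOn_eq hb hub hd hX hXmax]
  have hφlim : Tendsto (fun k => |φ X - φ (x k)|) atTop (𝓝 0) := by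
    have := (((hφ.tendsto X).comp hxlim).const_sub (φ X)).abs
    simpa using this
  rw [tendsto_iff_dist_tendsto_zero]
  refine squeeze_zero (fun _ => dist_nonneg) (fun k => ?_) hφlim
  rw [Real.dist_eq, sub_neg_eq_add]
  have h1 := inner_sub_le_legendreOn hb (hK.bddBelowOn (hwc k)) p hX
  have h2 := inner_sub_le_legendreOn hb hub p (hx k)
  have h3 := hxmax k
  set d := legendreOn K (fun x => u x + t k * φ x) p - legendreOn K u p
  -- Testing the perturbed transform at `X` and the unperturbed one at `x k` squeezes this quantity.
  have h4 : 0 ≤ d + t k * φ X := by simp only [d]; linarith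
  have h5 : d + t k * φ X ≤ t k * (φ X - φ (x k)) := by simp only [d]; linarith
  have h6 : d / t k + φ X = (d + t k * φ X) / t k := by
    have := ht0 k
    field_simp
  rw [h6, abs_div, abs_of_nonneg h4, div_le_iff₀ (abs_pos.2 (ht0 k)), ← abs_mul,
    mul_comm (φ X - φ (x k))]
  exact h5.trans (le_abs_self _)

variable [MeasurableSpace V] [BorelSpace V] [FiniteDimensional ℝ V] [Nontrivial V]

variable {Ω : Set V} {μ : Measure V} {g : V → ℝ}

/-- For large slopes, the Legendre transform is not affected by a change of the function on a
compact subset of the domain. -/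
theorem exists_forall_legendreOn_le (hΩ : IsConvexDomain Ω) (hg : IsBoundaryDatum Ω g) {C : Set V}
    (hC : IsCompact C) (hCΩ : C ⊆ Ω) (m : ℝ) : ∃ R : ℝ, ∀ w₁ w₂ : V → ℝ,
      (∀ x ∈ C, m ≤ w₁ x) → BddBelowOn (closure Ω) w₂ → EqOn w₂ g (frontier Ω) →
      (∀ x ∉ C, w₁ x = w₂ x) → ∀ p : V, R < ‖p‖ →
      legendreOn (closure Ω) w₁ p ≤ legendreOn (closure Ω) w₂ p := by
  obtain ⟨δ, hδ, hthick⟩ := hC.exists_cthickening_subset_open hΩ.isOpen hCΩ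
  obtain ⟨M, hM⟩ := hΩ.isCompact_frontier.bddAbove_image hg.continuousOn
  refine ⟨max ((M - m) / δ) 0, fun w₁ w₂ hw₁ hw₂ hw₂g heq p hp => ?_⟩
  have hp0 : 0 < ‖p‖ := (le_max_right _ _).trans_lt hp
  have hpR : M - m < δ * ‖p‖ := by
    rw [mul_comm]
    exact (div_lt_iff₀ hδ).1 ((le_max_left _ _).trans_lt hp)
  refine legendreOn_le hΩ.nonempty_closure fun x hx => ?_
  by_cases hxC : x ∈ C
  -- Moving from `x` by `δ` in the direction of `p` stays in the closure and gains `δ‖p‖ > M - m`,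
  -- so a frontier point does at least as well as `x`.
  · have h1 : x + (δ / ‖p‖) • p ∈ closure Ω := by
      refine subset_closure (hthick (mem_cthickening_of_dist_le _ x _ _ hxC ?_))
      rw [dist_eq_norm, add_sub_cancel_left, norm_smul, Real.norm_of_nonneg (by positivity),
        div_mul_cancel₀ _ hp0.ne']
    obtain ⟨y, hy, hxy⟩ := hΩ.exists_mem_frontier_inner_le h1 p
    have h2 : inner ℝ p (x + (δ / ‖p‖) • p) = inner ℝ p x + δ * ‖p‖ := by
      rw [inner_add_right, real_inner_smul_right, real_inner_self_eq_norm_sq]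
      field_simp
    have h3 := inner_sub_le_legendreOn hΩ.bounded_closure hw₂ p (frontier_subset_closure hy)
    rw [hw₂g hy] at h3
    have h4 : g y ≤ M := hM (mem_image_of_mem g hy)
    have h5 := hw₁ x hxC
    linarith
  · rw [heq x hxC]
    exact inner_sub_le_legendreOn hΩ.bounded_closure hw₂ p hx

theorem ae_differentiableAt_legendreOn {K : Set V} (hK : Bornology.IsBounded K)
    (hne : K.Nonempty) {u : V → ℝ} (hu : BddBelowOn K u) :
    ∀ᵐ p ∂(volume : Measure V), DifferentiableAt ℝ (legendreOn K u) p := by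
  obtain ⟨L, hL⟩ := exists_lipschitzWith_legendreOn hK hne hu
  exact hL.ae_differentiableAt

theorem measurable_gradient (f : V → ℝ) : Measurable (gradient f) :=
  (InnerProductSpace.toDual ℝ V).symm.continuous.measurable.comp (measurable_fderiv ℝ f)

section Perturbation

variable {u φ : V → ℝ} {C : Set V} (hΩ : IsConvexDomain Ω) (hμ : μ Ω < ⊤)
  (hg : IsBoundaryDatum Ω g) (hu : IsCompetitor Ω μ g u) (hφ : Continuous φ)
  (hφ1 : ∀ x, |φ x| ≤ 1) (hC : IsCompact C) (hCΩ : C ⊆ Ω) (hφC : ∀ x ∉ C, φ x = 0)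

include hΩ hg hu hφ hφ1 hC hCΩ hφC

/-- A ball of slopes independent of `t` carries the whole change of the transform. This keeps the
energy finite and dominates the difference quotients. -/
theorem exists_perturb_bounds : ∃ R : ℝ, ∀ t : ℝ, |t| ≤ 1 →
    IsCompetitor Ω μ g (fun x => u x + t * φ x) ∧ ∀ p,
      |legendreOn (closure Ω) (fun x => u x + t * φ x) p - legendreOn (closure Ω) u p|
        ≤ (closedBall (0 : V) R).indicator (fun _ => |t|) p := by
  obtain ⟨m, hm⟩ := hu.bddBelow
  have hm' : ∀ x ∈ C, m ≤ u x := fun x hx => hm x (subset_closure (hCΩ hx))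
  -- The bound `m - 1` holds for both `u` and its perturbations, so the comparison can be used both
  -- ways.
  obtain ⟨R, hR⟩ := exists_forall_legendreOn_le hΩ hg hC hCΩ (m - 1)
  refine ⟨R, fun t ht => ?_⟩
  have htφ : ∀ x, |t * φ x| ≤ |t| := fun x => by
    rw [abs_mul]
    exact mul_le_of_le_one_right (abs_nonneg _) (hφ1 x)
  have hlow : ∀ x ∈ closure Ω, m - 1 ≤ u x + t * φ x := fun x hx => by
    have h1 := hm x hx
    have h2 := abs_le.1 ((htφ x).trans ht)
    linarith
  have hwg : EqOn (fun x => u x + t * φ x) g (frontier Ω) := fun x hx => by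
    have : x ∉ C := fun h => hΩ.notMem_of_mem_frontier hx (hCΩ h)
    simp [hφC x this, hu.eqOn hx]
  have hbd : ∀ p,
      |legendreOn (closure Ω) (fun x => u x + t * φ x) p - legendreOn (closure Ω) u p|
        ≤ (closedBall (0 : V) R).indicator (fun _ => |t|) p := by
    intro p
    by_cases hp : p ∈ closedBall (0 : V) R
    · rw [indicator_of_mem hp]
      exact abs_legendreOn_sub_le hΩ.bounded_closure hΩ.nonempty_closure hu.bddBelow
        (fun x _ => by simpa using htφ x) p
    · rw [indicator_of_notMem hp]
      have hp' : R < ‖p‖ := by simpa using hp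
      have h1 := hR (fun x => u x + t * φ x) u
        (fun x hx => hlow x (subset_closure (hCΩ hx))) hu.bddBelow hu.eqOn
        (fun x hx => by simp [hφC x hx]) p hp'
      have h2 := hR u (fun x => u x + t * φ x)
        (fun x hx => by have := hm' x hx; linarith) ⟨_, hlow⟩ hwg
        (fun x hx => by simp [hφC x hx]) p hp'
      rw [abs_nonpos_iff]
      linarith
  refine ⟨⟨⟨_, hlow⟩, ?_, hwg, hu.aemeasurable.add (by fun_prop), ?_⟩, hbd⟩
  · obtain ⟨M, hM⟩ := hu.bddAbove
    refine ⟨M + 1, fun x hx => ?_⟩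
    have h1 := hM x hx
    have h2 := abs_le.1 ((htφ x).trans ht)
    linarith
  · have h1 : legendreEnergy Ω g (fun x => u x + t * φ x) ≤ legendreEnergy Ω g u
        + ∫⁻ p, (closedBall (0 : V) R).indicator (fun _ => ENNReal.ofReal |t|) p := by
      unfold legendreEnergy
      rw [← lintegral_add_left (hu.continuous_legendreOn_sub hΩ hg).measurable.ennreal_ofReal]
      refine lintegral_mono fun p => ?_
      have h2 := (le_abs_self _).trans (hbd p)
      by_cases hp : p ∈ closedBall (0 : V) R
      · rw [indicator_of_mem hp] at h2 ⊢
        rw [← ENNReal.ofReal_add (hu.legendreOn_sub_nonneg hΩ p) (abs_nonneg t)]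
        exact ENNReal.ofReal_le_ofReal (by linarith)
      · rw [indicator_of_notMem hp] at h2 ⊢
        rw [add_zero]
        exact ENNReal.ofReal_le_ofReal (by linarith)
    refine ne_top_of_le_ne_top (ENNReal.add_ne_top.2 ⟨hu.energy_ne_top, ?_⟩) h1
    rw [lintegral_indicator_const measurableSet_closedBall]
    exact ENNReal.mul_ne_top ENNReal.ofReal_ne_top measure_closedBall_lt_top.ne

/-- The integrand is, up to sign, an almost everywhere limit of difference quotients bounded by the
indicator of a ball. -/
theorem integrable_comp_gradient_legendreOn (huc : ContinuousOn u (closure Ω)) :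
    Integrable fun p => φ (gradient (legendreOn (closure Ω) u) p) := by
  obtain ⟨R, hR⟩ := exists_perturb_bounds hΩ hg hu hφ hφ1 hC hCΩ hφC
  have hI : Integrable ((closedBall (0 : V) R).indicator fun _ => (1 : ℝ)) :=
    (integrable_indicator_iff measurableSet_closedBall).2
      (integrableOn_const measure_closedBall_lt_top.ne)
  refine hI.mono' (hφ.measurable.comp (measurable_gradient _)).aestronglyMeasurable ?_
  filter_upwards [ae_differentiableAt_legendreOn hΩ.bounded_closure hΩ.nonempty_closure
    hu.bddBelow] with p hp
  have hpos : ∀ k : ℕ, 0 < 1 / ((k : ℝ) + 1) := fun k => by positivity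
  have hle : ∀ k : ℕ, |1 / ((k : ℝ) + 1)| ≤ 1 := fun k => by
    rw [abs_of_pos (hpos k), div_le_one (by positivity)]
    linarith [(Nat.cast_nonneg k : (0 : ℝ) ≤ k)]
  have hlim := (tendsto_legendreOn_perturb hΩ.isCompact_closure hΩ.nonempty_closure huc hφ hφ1 hp
    tendsto_one_div_add_atTop_nhds_zero_nat fun k => (hpos k).ne').norm
  rw [norm_neg] at hlim
  refine le_of_tendsto hlim (Eventually.of_forall fun k => ?_)
  have h1 := (hR _ (hle k)).2 p
  rw [norm_div, Real.norm_eq_abs, Real.norm_eq_abs, div_le_iff₀ (abs_pos.2 (hpos k).ne')]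
  by_cases hp : p ∈ closedBall (0 : V) R
  · rw [indicator_of_mem hp] at h1 ⊢
    rwa [one_mul]
  · rw [indicator_of_notMem hp] at h1 ⊢
    rwa [zero_mul]

include hμ

/-- The first variation of the functional. -/
theorem tendsto_dirichletFunctional_perturb (huc : ContinuousOn u (closure Ω)) {t : ℕ → ℝ}
    (ht : Tendsto t atTop (𝓝 0)) (ht0 : ∀ k, t k ≠ 0) (ht1 : ∀ k, |t k| ≤ 1) :
    Tendsto (fun k => (dirichletFunctional Ω μ g (fun x => u x + t k * φ x)
        - dirichletFunctional Ω μ g u) / t k) atTop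
      (𝓝 (-(∫ p, φ (gradient (legendreOn (closure Ω) u) p)) + ∫ x in Ω, φ x ∂μ)) := by
  obtain ⟨R, hR⟩ := exists_perturb_bounds hΩ hg hu hφ hφ1 hC hCΩ hφC
  have hIφ : IntegrableOn φ Ω μ := IsCompetitor.integrableOn_of_bounds hΩ hμ
    hφ.aemeasurable fun x _ => abs_le.1 (hφ1 x)
  have hcont : ∀ k, Continuous fun p =>
      legendreOn (closure Ω) (fun x => u x + t k * φ x) p - legendreOn (closure Ω) u p := fun k =>
    (continuous_legendreOn hΩ.bounded_closure hΩ.nonempty_closure (hR _ (ht1 k)).1.bddBelow).sub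
      (continuous_legendreOn hΩ.bounded_closure hΩ.nonempty_closure hu.bddBelow)
  have heq : ∀ k, (dirichletFunctional Ω μ g (fun x => u x + t k * φ x)
        - dirichletFunctional Ω μ g u) / t k
      = (∫ p, (legendreOn (closure Ω) (fun x => u x + t k * φ x) p
          - legendreOn (closure Ω) u p) / t k) + ∫ x in Ω, φ x ∂μ := by
    intro k
    have hw := (hR _ (ht1 k)).1
    unfold dirichletFunctional
    rw [hw.toReal_legendreEnergy hΩ hg, hu.toReal_legendreEnergy hΩ hg,
      integral_add (hu.integrableOn hΩ hμ) (hIφ.const_mul _), integral_const_mul, integral_div]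
    have h1 := integral_sub (hw.integrable_legendreOn_sub hΩ hg)
      (hu.integrable_legendreOn_sub hΩ hg)
    simp only [sub_sub_sub_cancel_right] at h1
    rw [h1]
    have := ht0 k
    field_simp
    ring
  simp_rw [heq]
  refine Tendsto.add_const _ ?_
  rw [← integral_neg]
  refine tendsto_integral_of_dominated_convergence
    ((closedBall (0 : V) R).indicator fun _ => (1 : ℝ))
    (fun k => ((hcont k).div_const _).aestronglyMeasurable) ?_ (fun k => ?_) ?_
  · exact (integrable_indicator_iff measurableSet_closedBall).2
      (integrableOn_const measure_closedBall_lt_top.ne)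
  · refine Eventually.of_forall fun p => ?_
    have h1 := (hR _ (ht1 k)).2 p
    rw [norm_div, Real.norm_eq_abs, Real.norm_eq_abs, div_le_iff₀ (abs_pos.2 (ht0 k))]
    by_cases hp : p ∈ closedBall (0 : V) R
    · rw [indicator_of_mem hp] at h1 ⊢
      rwa [one_mul]
    · rw [indicator_of_notMem hp] at h1 ⊢
      rwa [zero_mul]
  · filter_upwards [ae_differentiableAt_legendreOn hΩ.bounded_closure hΩ.nonempty_closure
      hu.bddBelow] with p hp
    exact tendsto_legendreOn_perturb hΩ.isCompact_closure hΩ.nonempty_closure huc hφ hφ1 hp ht ht0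

/-- The Euler–Lagrange equation of the functional. -/
theorem integral_gradient_legendreOn_eq (huc : ContinuousOn u (closure Ω))
    (hmin : ∀ w, IsCompetitor Ω μ g w → dirichletFunctional Ω μ g u ≤ dirichletFunctional Ω μ g w) :
    ∫ p, φ (gradient (legendreOn (closure Ω) u) p) = ∫ x in Ω, φ x ∂μ := by
  obtain ⟨R, hR⟩ := exists_perturb_bounds hΩ hg hu hφ hφ1 hC hCΩ hφC
  have hlim : Tendsto (fun k : ℕ => 1 / ((k : ℝ) + 1)) atTop (𝓝 0) :=
    tendsto_one_div_add_atTop_nhds_zero_nat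
  have hpos : ∀ k : ℕ, 0 < 1 / ((k : ℝ) + 1) := fun k => by positivity
  have hle : ∀ k : ℕ, |1 / ((k : ℝ) + 1)| ≤ 1 := fun k => by
    rw [abs_of_pos (hpos k), div_le_one (by positivity)]
    linarith [(Nat.cast_nonneg k : (0 : ℝ) ≤ k)]
  -- Steps `1/(k+1)` and `-1/(k+1)` give the two inequalities.
  have h1 := ge_of_tendsto (tendsto_dirichletFunctional_perturb hΩ hμ hg hu hφ hφ1 hC hCΩ hφC huc
    hlim (fun k => (hpos k).ne') hle) (b := 0) (Eventually.of_forall fun k =>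
      div_nonneg (sub_nonneg.2 (hmin _ (hR _ (hle k)).1)) (hpos k).le)
  have h2 := le_of_tendsto (tendsto_dirichletFunctional_perturb hΩ hμ hg hu hφ hφ1 hC hCΩ hφC huc
    (by simpa using hlim.neg) (fun k => (neg_neg_of_pos (hpos k)).ne)
    (fun k => by rw [abs_neg]; exact hle k)) (b := 0) (Eventually.of_forall fun k =>
      div_nonpos_of_nonneg_of_nonpos (sub_nonneg.2 (hmin _ (hR _ (by rw [abs_neg]; exact hle k)).1))
        (neg_nonpos.2 (hpos k).le))
  linarith

end Perturbation

end Variation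

/-! ### Comparing measures through test functions. -/

section Measures

variable {V : Type*} [NormedAddCommGroup V] [InnerProductSpace ℝ V] [MeasurableSpace V]
  [BorelSpace V] [FiniteDimensional ℝ V]

/-- Inner regularity supplies a closed `D ⊆ U` of almost full `ν₁`-measure, compact as `U` is
bounded; test with a cutoff between `D` and `U`. -/
theorem measure_le_of_forall_integral_eq {ν₁ ν₂ : Measure V} {U : Set V} (hU : IsOpen U)
    (hUb : Bornology.IsBounded U)
    (h : ∀ φ : V → ℝ, Continuous φ → (∀ x, 0 ≤ φ x) → (∀ x, φ x ≤ 1) →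
      ∀ C : Set V, IsCompact C → C ⊆ U → (∀ x ∉ C, φ x = 0) →
      Integrable φ ν₁ ∧ Integrable φ ν₂ ∧ ∫ x, φ x ∂ν₁ = ∫ x, φ x ∂ν₂) : ν₁ U ≤ ν₂ U := by
  refine le_of_forall_lt fun r hr => ?_
  obtain ⟨D, hDU, hD, hrD⟩ := Measure.InnerRegularWRT.of_pseudoMetrizableSpace ν₁ hU r hr
  have hDc : IsCompact D := isCompact_of_isClosed_isBounded hD (hUb.subset hDU)
  obtain ⟨C, hC, -, hDC, hCU⟩ := exists_compact_closed_between hDc hU hDU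
  obtain ⟨φ, hφ1, hφ0, -, hφ⟩ := exists_continuous_one_zero_of_isCompact hDc
    isOpen_interior.isClosed_compl (disjoint_compl_right_iff_subset.mpr hDC)
  obtain ⟨h1, h2, h3⟩ := h φ φ.continuous (fun x => (hφ x).1) (fun x => (hφ x).2) C hC hCU
    fun x hx => hφ0 fun hx' => hx (interior_subset hx')
  have h4 := ofReal_integral_eq_lintegral_ofReal h1 (Eventually.of_forall fun x => (hφ x).1)
  have h5 := ofReal_integral_eq_lintegral_ofReal h2 (Eventually.of_forall fun x => (hφ x).1)
  calc r < ν₁ D := hrD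
    _ = ∫⁻ x, D.indicator 1 x ∂ν₁ := (lintegral_indicator_one hD.measurableSet).symm
    _ ≤ ∫⁻ x, ENNReal.ofReal (φ x) ∂ν₁ := lintegral_mono fun x => by
      by_cases hx : x ∈ D
      · simp [hx, hφ1 hx]
      · simp [hx]
    _ = ∫⁻ x, ENNReal.ofReal (φ x) ∂ν₂ := by rw [← h4, ← h5, h3]
    _ ≤ ∫⁻ x, U.indicator 1 x ∂ν₂ := lintegral_mono fun x => by
      by_cases hx : x ∈ U
      · rw [indicator_of_mem hx]
        exact ENNReal.ofReal_le_one.2 (hφ x).2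
      · have : φ x = 0 := hφ0 fun hx' => hx (hCU (interior_subset hx'))
        simp [this]
    _ = ν₂ U := lintegral_indicator_one hU.measurableSet

theorem measure_eq_of_forall_isOpen {ν₁ ν₂ : Measure V} {Ω : Set V} (hΩ : IsOpen Ω)
    (hfin : ν₁ Ω < ⊤) (h : ∀ U ⊆ Ω, IsOpen U → ν₁ U = ν₂ U) {B : Set V} (hB : B ⊆ Ω)
    (hBm : MeasurableSet B) : ν₁ B = ν₂ B := by
  have : IsFiniteMeasure (ν₁.restrict Ω) := ⟨by simpa using hfin⟩
  have heq : ν₁.restrict Ω = ν₂.restrict Ω := by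
    refine ext_of_generate_finite {U : Set V | IsOpen U} ?_ isPiSystem_isOpen (fun U hU => ?_) ?_
    · exact BorelSpace.measurable_eq
    · rw [Measure.restrict_apply hU.measurableSet, Measure.restrict_apply hU.measurableSet]
      exact h _ inter_subset_right (hU.inter hΩ)
    · simpa using h Ω subset_rfl hΩ
  have h1 := congrArg (fun ν : Measure V => ν B) heq
  simpa [Measure.restrict_apply hBm, inter_eq_left.2 hB] using h1

end Measures

/-! ### The Alexandrov equation as a push-forward; existence. -/

section MongeAmpere

variable {n : ℕ} [Nontrivial (EuclideanSpace ℝ (Fin n))] {Ω : Set (EuclideanSpace ℝ (Fin n))}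

theorem mem_subdiff_iff_legendreOn_eq (hΩ : IsConvexDomain Ω) {u : EuclideanSpace ℝ (Fin n) → ℝ}
    (hu : ContinuousOn u (closure Ω)) {x p : EuclideanSpace ℝ (Fin n)} (hx : x ∈ Ω) :
    p ∈ subdiff Ω u x ↔ legendreOn (closure Ω) u p = inner ℝ p x - u x := by
  have hb := hΩ.isCompact_closure.bddBelowOn hu
  constructor
  · intro h
    refine le_antisymm (legendreOn_le hΩ.nonempty_closure fun y hy => ?_)
      (inner_sub_le_legendreOn hΩ.bounded_closure hb p (subset_closure hx))
    have hc : ContinuousOn (fun y => inner ℝ p y - u y) (closure Ω) := by fun_prop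
    have hmaps : MapsTo (fun y => inner ℝ p y - u y) Ω (Iic (inner ℝ p x - u x)) := fun z hz => by
      have h1 := h z hz
      rw [inner_sub_right] at h1
      show inner ℝ p z - u z ≤ inner ℝ p x - u x
      linarith
    have h2 := hmaps.closure_of_continuousOn hc hy
    rwa [closure_Iic] at h2
  · intro h y hy
    have h1 := inner_sub_le_legendreOn hΩ.bounded_closure hb p (subset_closure hy)
    rw [inner_sub_right]
    linarith

/-- The Monge–Ampère measure is the push-forward of the Lebesgue measure under the gradient of the
Legendre transform. -/
theorem mongeAmpere_eq_map_gradient (hΩ : IsConvexDomain Ω) {u : EuclideanSpace ℝ (Fin n) → ℝ}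
    (hu : ContinuousOn u (closure Ω)) {B : Set (EuclideanSpace ℝ (Fin n))} (hB : B ⊆ Ω)
    (hBm : MeasurableSet B) :
    mongeAmpere Ω u B = (volume.map (gradient (legendreOn (closure Ω) u))) B := by
  have hb := hΩ.isCompact_closure.bddBelowOn hu
  rw [Measure.map_apply (measurable_gradient _) hBm]
  refine measure_congr ?_
  -- Where the transform is differentiable, the maximiser is unique and equals the gradient.
  filter_upwards [ae_differentiableAt_legendreOn hΩ.bounded_closure hΩ.nonempty_closure hb]
    with p hp
  refine propext ?_
  show p ∈ ⋃ x ∈ B, subdiff Ω u x ↔ gradient (legendreOn (closure Ω) u) p ∈ B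
  constructor
  · intro h
    obtain ⟨x, hx, hpx⟩ := mem_iUnion₂.1 h
    rwa [gradient_legendreOn_eq hΩ.bounded_closure hb hp (subset_closure (hB hx))
      ((mem_subdiff_iff_legendreOn_eq hΩ hu (hB hx)).1 hpx)]
  · intro h
    obtain ⟨x, hx, hpx⟩ := exists_legendreOn_eq hΩ.isCompact_closure hΩ.nonempty_closure hu p
    rw [gradient_legendreOn_eq hΩ.bounded_closure hb hp hx hpx] at h
    exact mem_iUnion₂.2 ⟨x, h, (mem_subdiff_iff_legendreOn_eq hΩ hu (hB h)).2 hpx⟩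

variable {μ : Measure (EuclideanSpace ℝ (Fin n))} {g : EuclideanSpace ℝ (Fin n) → ℝ}

theorem exists_isAlexandrovSolution (hΩ : IsConvexDomain Ω) (hμ : μ Ω < ⊤)
    (hg : IsBoundaryDatum Ω g) :
    ∃ u, IsAlexandrovSolution Ω μ g u := by
  obtain ⟨u, hu, huc, hconv, hmin⟩ := exists_minimizer hΩ hμ hg
  refine ⟨u, huc, hconv.subset subset_closure hΩ.convex, fun B hB hBm => ?_, hu.eqOn⟩
  rw [mongeAmpere_eq_map_gradient hΩ huc hB hBm]
  refine (measure_eq_of_forall_isOpen hΩ.isOpen hμ (fun U hU hUo => ?_) hB hBm).symm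
  have hX : Measurable (gradient (legendreOn (closure Ω) u)) := measurable_gradient _
  have key : ∀ φ : EuclideanSpace ℝ (Fin n) → ℝ, Continuous φ → (∀ x, 0 ≤ φ x) →
      (∀ x, φ x ≤ 1) → ∀ C, IsCompact C → C ⊆ U → (∀ x ∉ C, φ x = 0) →
      Integrable φ (μ.restrict Ω) ∧
      Integrable φ (volume.map (gradient (legendreOn (closure Ω) u))) ∧
      ∫ x, φ x ∂(μ.restrict Ω) = ∫ x, φ x ∂(volume.map (gradient (legendreOn (closure Ω) u))) := by
    intro φ hφ h0 h1 C hC hCU hφC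
    have hφ1 : ∀ x, |φ x| ≤ 1 := fun x => abs_le.2 ⟨by linarith [h0 x], h1 x⟩
    refine ⟨IsCompetitor.integrableOn_of_bounds hΩ hμ hφ.aemeasurable fun x _ => abs_le.1 (hφ1 x),
      ?_, ?_⟩
    · rw [integrable_map_measure hφ.aestronglyMeasurable hX.aemeasurable]
      exact integrable_comp_gradient_legendreOn hΩ hg hu hφ hφ1 hC (hCU.trans hU) hφC huc
    · rw [integral_map hX.aemeasurable hφ.aestronglyMeasurable]
      exact (integral_gradient_legendreOn_eq hΩ hμ hg hu hφ hφ1 hC (hCU.trans hU) hφC huc hmin).symm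
  have hUb := hΩ.bounded.subset hU
  have h1 : (μ.restrict Ω) U = μ U := by
    rw [Measure.restrict_apply hUo.measurableSet, inter_eq_left.2 hU]
  rw [← h1]
  exact le_antisymm (measure_le_of_forall_integral_eq hUo hUb key)
    (measure_le_of_forall_integral_eq hUo hUb fun φ h2 h3 h4 C h5 h6 h7 =>
      have h := key φ h2 h3 h4 C h5 h6 h7
      ⟨h.2.1, h.1, h.2.2.symm⟩)

end MongeAmpere

/-! ### Uniqueness. -/

section Uniqueness

/-- Two functions with a common subgradient at each point of a convex set differ by a constant. -/
theorem sub_eq_sub_of_common_subgradient {V : Type*} [NormedAddCommGroup V]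
    [InnerProductSpace ℝ V] {Ω : Set V} (hΩ : Convex ℝ Ω) {u v : V → ℝ}
    (h : ∀ x ∈ Ω, ∃ p : V, (∀ y ∈ Ω, u x + inner ℝ p (y - x) ≤ u y) ∧
      ∀ y ∈ Ω, v x + inner ℝ p (y - x) ≤ v y) {x y : V} (hx : x ∈ Ω) (hy : y ∈ Ω) :
    u y - v y = u x - v x := by
  choose! P hPu hPv using h
  set d := y - x
  let z : ℕ → ℕ → V := fun N k => x + ((k : ℝ) / N) • d
  have hz : ∀ N k, k ≤ N → 0 < N → z N k ∈ Ω := fun N k hk hN => by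
    have hN' : (0 : ℝ) < N := by exact_mod_cast hN
    have hk' : (k : ℝ) ≤ N := by exact_mod_cast hk
    exact hΩ.add_smul_sub_mem hx hy ⟨by positivity, (div_le_one hN').2 hk'⟩
  -- Over one of `N` equal pieces the increments of `u` and `v` both lie between the end slopes over
  -- `N`. Summed, the errors telescope to `O(1/N)`.
  have hstep : ∀ N k, k + 1 ≤ N →
      |(u (z N (k + 1)) - v (z N (k + 1))) - (u (z N k) - v (z N k))|
        ≤ (inner ℝ (P (z N (k + 1))) d - inner ℝ (P (z N k)) d) / N := by
    intro N k hk
    have hN : 0 < N := by omega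
    have ha := hz N k (by omega) hN
    have hb := hz N (k + 1) hk hN
    have h1 : z N (k + 1) - z N k = (1 / (N : ℝ)) • d := by
      simp only [z, add_sub_add_left_eq_sub, ← sub_smul]
      congr 1
      push_cast
      ring
    have h2 : z N k - z N (k + 1) = -((1 / (N : ℝ)) • d) := by rw [← h1, neg_sub]
    have u1 := hPu _ ha _ hb
    have u2 := hPu _ hb _ ha
    have v1 := hPv _ ha _ hb
    have v2 := hPv _ hb _ ha
    rw [h1, real_inner_smul_right] at u1 v1
    rw [h2, inner_neg_right, real_inner_smul_right] at u2 v2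
    rw [sub_div, abs_le]
    constructor <;> · ring_nf at *; linarith
  have hchain : ∀ N k, k ≤ N → |(u (z N k) - v (z N k)) - (u x - v x)|
        ≤ (inner ℝ (P (z N k)) d - inner ℝ (P x) d) / N := by
    intro N k
    induction k with
    | zero => intro _; simp [z]
    | succ k ih =>
      intro hk
      have h1 := hstep N k hk
      have h2 := ih (by omega)
      have h3 := abs_sub_le (u (z N (k + 1)) - v (z N (k + 1))) (u (z N k) - v (z N k)) (u x - v x)
      rw [sub_div] at h1 h2 ⊢
      linarith
  have hfin : ∀ N : ℕ, |(u y - v y) - (u x - v x)|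
      ≤ (inner ℝ (P y) d - inner ℝ (P x) d) / ((N : ℝ) + 1) := fun N => by
    have h1 := hchain (N + 1) (N + 1) le_rfl
    have h2 : z (N + 1) (N + 1) = y := by
      have : ((N + 1 : ℕ) : ℝ) ≠ 0 := by positivity
      show x + (((N + 1 : ℕ) : ℝ) / ((N + 1 : ℕ) : ℝ)) • d = y
      rw [div_self this, one_smul, add_sub_cancel]
    rw [h2] at h1
    exact_mod_cast h1
  have hlim : Tendsto (fun N : ℕ => (inner ℝ (P y) d - inner ℝ (P x) d) / ((N : ℝ) + 1)) atTop
      (𝓝 0) := by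
    have := (tendsto_one_div_add_atTop_nhds_zero_nat (𝕜 := ℝ)).const_mul
      (inner ℝ (P y) d - inner ℝ (P x) d)
    simpa [div_eq_mul_inv] using this
  have h0 := ge_of_tendsto' hlim hfin
  exact sub_eq_zero.1 (abs_nonpos_iff.1 h0)

variable {n : ℕ} [Nontrivial (EuclideanSpace ℝ (Fin n))] {Ω : Set (EuclideanSpace ℝ (Fin n))}
  {μ : Measure (EuclideanSpace ℝ (Fin n))} {g u v w : EuclideanSpace ℝ (Fin n) → ℝ}

/-- Test `w*` at the maximiser for `u`. If it lies on the frontier, `u` and `w` agree there, which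
is why the indicator is harmless. -/
theorem ae_indicator_sub_gradient_le (hΩ : IsConvexDomain Ω) (hu : ContinuousOn u (closure Ω))
    (hw : ContinuousOn w (closure Ω)) (huw : EqOn u w (frontier Ω)) :
    ∀ᵐ p ∂(volume : Measure (EuclideanSpace ℝ (Fin n))),
      Ω.indicator (fun x => u x - w x) (gradient (legendreOn (closure Ω) u) p)
        ≤ legendreOn (closure Ω) w p - legendreOn (closure Ω) u p := by
  have hK := hΩ.isCompact_closure
  filter_upwards [ae_differentiableAt_legendreOn hΩ.bounded_closure hΩ.nonempty_closure
    (hK.bddBelowOn hu)] with p hp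
  obtain ⟨x, hx, hpx⟩ := exists_legendreOn_eq hK hΩ.nonempty_closure hu p
  rw [gradient_legendreOn_eq hΩ.bounded_closure (hK.bddBelowOn hu) hp hx hpx]
  have h1 := inner_sub_le_legendreOn hΩ.bounded_closure (hK.bddBelowOn hw) p hx
  by_cases hxΩ : x ∈ Ω
  · rw [indicator_of_mem hxΩ]
    linarith
  · rw [indicator_of_notMem hxΩ]
    have h2 := huw (hΩ.mem_frontier hx hxΩ)
    linarith

namespace IsAlexandrovSolution

theorem restrict_map_gradient (hΩ : IsConvexDomain Ω) (hu : IsAlexandrovSolution Ω μ g u) :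
    (volume.map (gradient (legendreOn (closure Ω) u))).restrict Ω = μ.restrict Ω := by
  ext B hB
  rw [Measure.restrict_apply hB, Measure.restrict_apply hB,
    ← mongeAmpere_eq_map_gradient hΩ hu.continuousOn inter_subset_right
      (hB.inter hΩ.isOpen.measurableSet),
    hu.mongeAmpere_eq _ inter_subset_right (hB.inter hΩ.isOpen.measurableSet)]

theorem integral_indicator_gradient (hΩ : IsConvexDomain Ω) (hμ : μ Ω < ⊤)
    (hu : IsAlexandrovSolution Ω μ g u) {f : EuclideanSpace ℝ (Fin n) → ℝ}
    (hf : ContinuousOn f (closure Ω)) :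
    Integrable (fun p => Ω.indicator f (gradient (legendreOn (closure Ω) u) p)) ∧
      ∫ p, Ω.indicator f (gradient (legendreOn (closure Ω) u) p) = ∫ x in Ω, f x ∂μ := by
  classical
  have hX : Measurable (gradient (legendreOn (closure Ω) u)) := measurable_gradient _
  have hm := hΩ.isOpen.measurableSet
  have hfm : Measurable (Ω.indicator f) := by
    rw [← piecewise_eq_indicator]
    exact (hf.mono subset_closure).measurable_piecewise continuousOn_const hm
  obtain ⟨b, hb⟩ := hΩ.isCompact_closure.exists_bound_of_continuousOn hf
  have hI : IntegrableOn f Ω μ := IsCompetitor.integrableOn_of_bounds hΩ hμ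
    ((hf.mono subset_closure).aemeasurable hm) fun x hx => abs_le.1 (hb x (subset_closure hx))
  constructor
  · refine (integrable_map_measure hfm.aestronglyMeasurable hX.aemeasurable).1 ?_
    rw [integrable_indicator_iff hm, IntegrableOn, hu.restrict_map_gradient hΩ]
    exact hI
  · rw [← integral_map (f := Ω.indicator f) hX.aemeasurable hfm.aestronglyMeasurable,
      integral_indicator hm, hu.restrict_map_gradient hΩ]

theorem eqOn (hΩ : IsConvexDomain Ω) (hμ : μ Ω < ⊤) (hu : IsAlexandrovSolution Ω μ g u)
    (hv : IsAlexandrovSolution Ω μ g v) : EqOn v u (closure Ω) := by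
  have hK := hΩ.isCompact_closure
  have hKb := hΩ.bounded_closure
  have hne := hΩ.nonempty_closure
  have huv : EqOn u v (frontier Ω) := fun x hx => (hu.boundary x hx).trans (hv.boundary x hx).symm
  let w : EuclideanSpace ℝ (Fin n) → ℝ := fun x => (u x + v x) / 2
  have hwc : ContinuousOn w (closure Ω) := (hu.continuousOn.add hv.continuousOn).div_const 2
  have hub := hK.bddBelowOn hu.continuousOn
  have hvb := hK.bddBelowOn hv.continuousOn
  have hwb := hK.bddBelowOn hwc
  have hdc : ContinuousOn (fun x => u x - v x) (closure Ω) := hu.continuousOn.sub hv.continuousOn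
  obtain ⟨hIu, hiu⟩ := hu.integral_indicator_gradient hΩ hμ hdc
  obtain ⟨hIv, hiv⟩ := hv.integral_indicator_gradient hΩ hμ hdc
  have h1 := ae_indicator_sub_gradient_le hΩ hu.continuousOn hv.continuousOn huv
  have h2 := ae_indicator_sub_gradient_le hΩ hv.continuousOn hu.continuousOn huv.symm
  have h3 := ae_indicator_sub_gradient_le hΩ hu.continuousOn hwc fun x hx => by
    show u x = (u x + v x) / 2
    rw [← huv hx]
    ring
  have hneg : ∀ x, Ω.indicator (fun x => v x - u x) x = -Ω.indicator (fun x => u x - v x) x :=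
    fun x => by by_cases hx : x ∈ Ω <;> simp [hx]
  have hhalf : ∀ x, Ω.indicator (fun x => u x - w x) x
      = Ω.indicator (fun x => u x - v x) x / 2 := fun x => by
    by_cases hx : x ∈ Ω
    · simp only [indicator_of_mem hx, w]
      ring
    · simp [hx]
  simp_rw [hneg] at h2
  simp_rw [hhalf] at h3
  -- Both sides enclose `v* - u*`. Their integrals both equal `∫_Ω (u - v) dμ`, so they agree almost
  -- everywhere.
  have hle : ∀ᵐ p ∂(volume : Measure (EuclideanSpace ℝ (Fin n))),
      Ω.indicator (fun x => u x - v x) (gradient (legendreOn (closure Ω) u) p)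
      ≤ Ω.indicator (fun x => u x - v x) (gradient (legendreOn (closure Ω) v) p) := by
    filter_upwards [h1, h2] with p hp1 hp2
    linarith
  have heq := (integral_eq_iff_of_ae_le hIu hIv hle).1 (hiu.trans hiv.symm)
  have hmid : legendreOn (closure Ω) w
      =ᵐ[volume] fun p => (legendreOn (closure Ω) u p + legendreOn (closure Ω) v p) / 2 := by
    filter_upwards [h1, h2, h3, heq] with p hp1 hp2 hp3 hp4
    have h4 := legendreOn_half_add_le hKb hne hub hvb p
    change legendreOn (closure Ω) w p ≤ _ at h4
    linarith
  have hmid' := (Continuous.ae_eq_iff_eq volume (continuous_legendreOn hKb hne hwb)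
    (((continuous_legendreOn hKb hne hub).add (continuous_legendreOn hKb hne hvb)).div_const 2)).1
    hmid
  have hwconv : ConvexOn ℝ Ω w := by
    have h5 := (hu.convexOn.add hv.convexOn).smul (c := (1 / 2 : ℝ)) (by norm_num)
    refine h5.congr fun x _ => ?_
    simp only [Pi.add_apply, smul_eq_mul, w]
    ring
  -- For a subgradient `p` of the mean at `x`, the Fenchel inequalities of `u` and `v` sum to an
  -- equality, so each is one.
  have hcommon : ∀ x ∈ Ω, ∃ p, (∀ y ∈ Ω, u x + inner ℝ p (y - x) ≤ u y) ∧
      ∀ y ∈ Ω, v x + inner ℝ p (y - x) ≤ v y := by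
    intro x hx
    obtain ⟨p, hp⟩ := hwconv.exists_inner_le hΩ.isOpen hx
    have h5 := (mem_subdiff_iff_legendreOn_eq hΩ hwc hx).1 hp
    have h6 : legendreOn (closure Ω) w p
        = (legendreOn (closure Ω) u p + legendreOn (closure Ω) v p) / 2 := congrFun hmid' p
    have h7 := inner_sub_le_legendreOn hKb hub p (subset_closure hx)
    have h8 := inner_sub_le_legendreOn hKb hvb p (subset_closure hx)
    have h9 : w x = (u x + v x) / 2 := rfl
    exact ⟨p, (mem_subdiff_iff_legendreOn_eq hΩ hu.continuousOn hx).2 (by linarith),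
      (mem_subdiff_iff_legendreOn_eq hΩ hv.continuousOn hx).2 (by linarith)⟩
  obtain ⟨x₀, hx₀⟩ := hΩ.nonempty
  have hconst : EqOn (fun x => u x - v x) (fun _ => u x₀ - v x₀) (closure Ω) :=
    Set.EqOn.of_subset_closure
      (fun x hx => sub_eq_sub_of_common_subgradient hΩ.convex hcommon hx₀ hx) hdc
      continuousOn_const subset_closure subset_rfl
  obtain ⟨y, hy⟩ := hΩ.nonempty_frontier
  have h5 := hconst (frontier_subset_closure hy)
  intro x hx
  have h6 := hconst hx
  have h7 := huv hy
  simp only at h5 h6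
  linarith

end IsAlexandrovSolution

end Uniqueness

/-! ### Compactness of convex hulls. -/

section ConvexHull

variable {E : Type*} [NormedAddCommGroup E] [NormedSpace ℝ E] [FiniteDimensional ℝ E]

/-- Carathéodory: the hull is the continuous image of a simplex times `dim + 1` copies of `s`,
shorter combinations being padded with zero weights. -/
theorem IsCompact.isCompact_convexHull {s : Set E} (hs : IsCompact s) :
    IsCompact (convexHull ℝ s) := by
  classical
  set m := Module.finrank ℝ E + 1
  let Φ : (Fin m → ℝ) × (Fin m → E) → E := fun q => ∑ i, q.1 i • q.2 i
  have hΦ : Continuous Φ := by fun_prop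
  have hK : IsCompact (stdSimplex ℝ (Fin m) ×ˢ univ.pi fun _ : Fin m => s) :=
    (isCompact_stdSimplex ℝ (Fin m)).prod (isCompact_univ_pi fun _ => hs)
  convert hK.image hΦ using 1
  refine Subset.antisymm (fun x hx => ?_) ?_
  · obtain ⟨ι, _, z, w, hzs, hz, hw, hw1, hx⟩ := eq_pos_convex_span_of_mem_convexHull hx
    have hι : Nonempty ι := by
      by_contra h
      rw [not_nonempty_iff] at h
      simp at hw1
    obtain ⟨i₀⟩ := hι
    obtain ⟨e⟩ : Nonempty (ι ↪ Fin m) := Function.Embedding.nonempty_of_card_le (by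
      rw [Fintype.card_fin]
      exact hz.card_le_finrank_succ.trans (Nat.succ_le_succ (Submodule.finrank_le _)))
    let w' : Fin m → ℝ := Function.extend e w 0
    let z' : Fin m → E := Function.extend e z fun _ => z i₀
    have hw' : ∀ i, w' (e i) = w i := fun i => e.injective.extend_apply _ _ _
    have hz' : ∀ i, z' (e i) = z i := fun i => e.injective.extend_apply _ _ _
    have hw0 : ∀ j, j ∉ range e → w' j = 0 := fun j hj =>
      Function.extend_apply' _ _ _ fun ⟨i, hi⟩ => hj ⟨i, hi⟩
    refine ⟨(w', z'), ⟨⟨fun j => ?_, ?_⟩, fun j _ => ?_⟩, ?_⟩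
    · by_cases hj : j ∈ range e
      · obtain ⟨i, rfl⟩ := hj
        show 0 ≤ w' (e i)
        rw [hw']
        exact (hw i).le
      · exact (hw0 j hj).symm.le
    · rw [← hw1]
      exact (Fintype.sum_of_injective e e.injective w w' hw0 fun i => (hw' i).symm).symm
    · by_cases hj : j ∈ range e
      · obtain ⟨i, rfl⟩ := hj
        show z' (e i) ∈ s
        rw [hz']
        exact hzs (mem_range_self i)
      · have : z' j = z i₀ := Function.extend_apply' _ _ _ fun ⟨i, hi⟩ => hj ⟨i, hi⟩
        show z' j ∈ s
        rw [this]
        exact hzs (mem_range_self i₀)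
    · rw [← hx]
      refine (Fintype.sum_of_injective e e.injective (fun i => w i • z i)
        (fun j => w' j • z' j) (fun j hj => ?_) fun i => ?_).symm
      · simp [hw0 j hj]
      · simp [hw', hz']
  · rintro _ ⟨⟨w, z⟩, ⟨hw, hz⟩, rfl⟩
    exact (convex_convexHull ℝ s).sum_mem (fun i _ => hw.1 i) hw.2
      fun i _ => subset_convexHull ℝ s (hz i (mem_univ i))

end ConvexHull

/-! ### Polytopes: convex boundary data are suprema of affine functions. -/

section Polytope

variable {n : ℕ} {Ω : Set (EuclideanSpace ℝ (Fin n))}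

theorem IsSimplePolytope.isConvexDomain (h : IsSimplePolytope Ω) : IsConvexDomain Ω := by
  obtain ⟨N, l, hl⟩ := h.halfspaces
  refine ⟨?_, ?_, h.bounded, h.nonempty⟩
  · rw [hl, ofPred_forall]
    exact isOpen_iInter_of_finite fun i =>
      isOpen_lt continuous_const (l i).continuous_of_finiteDimensional
  · rw [hl, ofPred_forall]
    exact convex_iInter fun i => (convex_Ioi (0 : ℝ)).affine_preimage (l i)

/-- Each boundary point of a polytope lies in a hyperplane that supports it. -/
theorem IsSimplePolytope.exists_face (h : IsSimplePolytope Ω) {x : EuclideanSpace ℝ (Fin n)}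
    (hx : x ∈ frontier Ω) : ∃ l : EuclideanSpace ℝ (Fin n) →ᵃ[ℝ] ℝ, l x = 0 ∧
      (∀ y ∈ closure Ω, 0 ≤ l y) ∧ ∀ y ∈ closure Ω, l y = 0 → y ∈ frontier Ω := by
  obtain ⟨N, l, hl⟩ := h.halfspaces
  have hnonneg : ∀ i, ∀ y ∈ closure Ω, 0 ≤ l i y := fun i y hy => by
    have hcl : IsClosed {y | 0 ≤ l i y} :=
      isClosed_le continuous_const (l i).continuous_of_finiteDimensional
    refine closure_minimal (fun z hz => ?_) hcl hy
    rw [hl] at hz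
    exact (hz i).le
  have hxn := h.isConvexDomain.notMem_of_mem_frontier hx
  have hex : ∃ i, ¬ 0 < l i x := by
    by_contra hcon
    push Not at hcon
    exact hxn (by rw [hl]; exact hcon)
  obtain ⟨i, hi⟩ := hex
  refine ⟨l i, le_antisymm (not_lt.1 hi) (hnonneg i x (frontier_subset_closure hx)), hnonneg i,
    fun y hy hy0 => h.isConvexDomain.mem_frontier hy fun hyΩ => ?_⟩
  rw [hl] at hyΩ
  exact (hyΩ i).ne' hy0

/-- The set `T` imposes the inequality only over the face `l = 0` through `x`. It is convex: `l ≥ 0`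
forces both end points of a combination on the face to lie on it, and there convexity of `g`
applies. -/
theorem ConvexAlong.le_of_mem_convexHull (h : IsSimplePolytope Ω)
    {g : EuclideanSpace ℝ (Fin n) → ℝ} (hg : ConvexAlong (frontier Ω) g)
    {x : EuclideanSpace ℝ (Fin n)} (hx : x ∈ frontier Ω) {t : ℝ}
    (ht : (x, t) ∈ convexHull ℝ ((fun y => (y, g y)) '' frontier Ω)) : g x ≤ t := by
  obtain ⟨l, hlx, hl, hlf⟩ := h.exists_face hx
  let T : Set (EuclideanSpace ℝ (Fin n) × ℝ) := {q | q.1 ∈ closure Ω ∧ (l q.1 = 0 → g q.1 ≤ q.2)}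
  have hT : Convex ℝ T := by
    rw [convex_iff_forall_pos]
    rintro ⟨y, s⟩ ⟨hy, hys⟩ ⟨z, r⟩ ⟨hz, hzr⟩ a b ha hb hab
    have hmem := h.isConvexDomain.convex.closure hy hz ha.le hb.le hab
    refine ⟨hmem, fun h0 => ?_⟩
    simp only [Prod.fst_add, Prod.smul_fst, Prod.snd_add, Prod.smul_snd, smul_eq_mul] at h0 hmem ⊢
    have h1 : l (a • y + b • z) = a * l y + b * l z := by
      rw [Convex.combo_affine_apply hab]
      simp
    have h2 := mul_nonneg ha.le (hl y hy)
    have h3 := mul_nonneg hb.le (hl z hz)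
    rw [h1] at h0
    have h4 : l y = 0 := (mul_eq_zero.1 (by linarith : a * l y = 0)).resolve_left ha.ne'
    have h5 : l z = 0 := (mul_eq_zero.1 (by linarith : b * l z = 0)).resolve_left hb.ne'
    have hb' : b = 1 - a := by linarith
    have h6 := hg y (hlf y hy h4) z (hlf z hz h5) a ⟨ha.le, by linarith⟩
      (by rw [← hb']; exact hlf _ hmem (by rw [h1]; exact h0))
    rw [← hb'] at h6
    have h7 := mul_le_mul_of_nonneg_left (hys h4) ha.le
    have h8 := mul_le_mul_of_nonneg_left (hzr h5) hb.le
    simp only at h7 h8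
    linarith
  have hsub : (fun y => (y, g y)) '' frontier Ω ⊆ T := by
    rintro _ ⟨y, hy, rfl⟩
    exact ⟨frontier_subset_closure hy, fun _ => le_rfl⟩
  exact (convexHull_min hsub hT ht).2 hlx

/-- Separate the compact hull of the graph from the closed vertical ray below `(x, c')`, with `c <
c' < g x`; the separating hyperplane is not vertical and gives the affine minorant. -/
theorem IsSimplePolytope.isBoundaryDatum (h : IsSimplePolytope Ω)
    {g : EuclideanSpace ℝ (Fin n) → ℝ} (hg : ContinuousOn g (frontier Ω))
    (hgc : ConvexAlong (frontier Ω) g) : IsBoundaryDatum Ω g := by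
  refine ⟨hg, fun x hx c hc => ?_⟩
  have hΩ := h.isConvexDomain
  set G := (fun y => (y, g y)) '' frontier Ω
  have hG : IsCompact (convexHull ℝ G) := IsCompact.isCompact_convexHull
    (hΩ.isCompact_frontier.image_of_continuousOn (continuousOn_id.prodMk hg))
  obtain ⟨c', hcc', hc'⟩ := exists_between hc
  have hray : Convex ℝ ({x} ×ˢ Iic c') := (convex_singleton x).prod (convex_Iic c')
  have hrayc : IsClosed ({x} ×ˢ Iic c') := isClosed_singleton.prod isClosed_Iic
  have hdisj : Disjoint (convexHull ℝ G) ({x} ×ˢ Iic c') := by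
    rw [Set.disjoint_left]
    rintro ⟨y, t⟩ hyt ⟨hy, ht⟩
    obtain rfl : y = x := hy
    exact absurd (hgc.le_of_mem_convexHull h hx hyt) (not_le.2 (lt_of_le_of_lt ht hc'))
  obtain ⟨f, α, β, hα, hαβ, hβ⟩ :=
    geometric_hahn_banach_compact_closed (convex_convexHull ℝ G) hG hray hrayc hdisj
  set a := f (0, 1)
  have hsplit : ∀ (y : EuclideanSpace ℝ (Fin n)) (t : ℝ), f (y, t) = f (y, 0) + t * a := by
    intro y t
    have : ((y, t) : EuclideanSpace ℝ (Fin n) × ℝ) = (y, 0) + t • (0, 1) := by simp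
    rw [this, map_add, map_smul, smul_eq_mul]
  have hfr : ∀ y ∈ frontier Ω, f (y, 0) + g y * a < α := fun y hy => by
    rw [← hsplit]
    exact hα _ (subset_convexHull ℝ G (mem_image_of_mem _ hy))
  have hxr : β < f (x, 0) + c' * a := by
    rw [← hsplit]
    exact hβ (x, c') ⟨rfl, le_refl c'⟩
  have ha : a < 0 := by
    have h1 := hfr x hx
    by_contra hcon
    have h2 := mul_le_mul_of_nonneg_right hc'.le (not_lt.1 hcon)
    linarith
  let L : EuclideanSpace ℝ (Fin n) →L[ℝ] ℝ := f.comp (ContinuousLinearMap.inl ℝ _ ℝ)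
  refine ⟨(InnerProductSpace.toDual ℝ _).symm ((-a)⁻¹ • L), ?_⟩
  have hin : ∀ y, inner ℝ ((InnerProductSpace.toDual ℝ _).symm ((-a)⁻¹ • L)) y
      = (-a)⁻¹ * f (y, 0) := fun y => by
    rw [InnerProductSpace.toDual_symm_apply]
    rfl
  have hle : legendreOn (frontier Ω) g ((InnerProductSpace.toDual ℝ _).symm ((-a)⁻¹ • L))
      ≤ (-a)⁻¹ * f (x, 0) - c' := legendreOn_le ⟨x, hx⟩ fun y hy => by
    rw [hin]
    have h1 := hfr y hy
    have h2 : f (y, 0) + g y * a ≤ f (x, 0) + c' * a := by linarith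
    have h3 := mul_le_mul_of_nonneg_left h2 (inv_nonneg.2 (neg_nonneg.2 ha.le))
    have h4 : ∀ s : ℝ, (-a)⁻¹ * (s * a) = -s := fun s => by
      have := ha.ne
      field_simp
    rw [mul_add, mul_add, h4, h4] at h3
    linarith
  rw [hin]
  linarith

end Polytope

/-! ### The Dirichlet problem on a simple polytope. -/

theorem theoremB1 (n : ℕ) (hn : 1 ≤ n) (Ω : Set (EuclideanSpace ℝ (Fin n)))
    (hΩ : IsSimplePolytope Ω)
    (μ : MeasureTheory.Measure (EuclideanSpace ℝ (Fin n))) (hμ : μ Ω < ⊤)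
    (g : EuclideanSpace ℝ (Fin n) → ℝ) (hg : ContinuousOn g (frontier Ω))
    (hgconv : ConvexAlong (frontier Ω) g) :
    ∃ u : EuclideanSpace ℝ (Fin n) → ℝ, IsAlexandrovSolution Ω μ g u ∧
      ∀ v : EuclideanSpace ℝ (Fin n) → ℝ, IsAlexandrovSolution Ω μ g v →
        Set.EqOn v u (closure Ω) := by
  have : Nonempty (Fin n) := ⟨⟨0, hn⟩⟩
  have hd := hΩ.isConvexDomain
  obtain ⟨u, hu⟩ := exists_isAlexandrovSolution hd hμ (hΩ.isBoundaryDatum hg hgconv)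
  exact ⟨u, hu, fun v hv => hu.eqOn hd hμ hv⟩
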